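/- **Setting.** Let $\rho_0$ be an unknown density operator on $\mathbb C^d$, let $\{P_j\}_{j=1}^M$ be an unknown detector (positive semidefinite matrices with $\sum_jP_j=I$), and let $\mathcal E_a(X)=\sum_{i=1}^{d^2}A_i^aX(A_i^a)^\dagger$, $\sum_i(A_i^a)^\dagger A_i^a\le I$, $a=1,\dots,L$, be known processes; $\mathcal E_a$ is trace preserving (TP) if equality holds. Put $\rho_a=\mathcal E_a(\rho_0)$ and $\mathcal B_a=\sum_i(A_i^a)^*\otimes A_i^a$. $\|\cdot\|$ is the Frobenius norm, and $\operatorname{vec}$ stacks columns. All copies are measured independently according to Born's rule (a copy of $\rho_a$ is lost with probability $1-\operatorname{Tr}\rho_a$), $N_0\ge1$ copies are used in each experiment, and $\mathbb E$ is the expectation over all measurement results. In what follows a quotient with denominator $0$ is read as $0$. **Corrections.** (i) A Hermitian $\bar\rho_0$ of trace one with eigenvalues $\lambda_1\ge\dots\ge\lambda_d$ is replaced by $\hat\rho_0$ with the same eigenvectors and eigenvalues $\mu_i=\lambda_i+\frac1m\sum_{k>m}\lambda_k$ for $i\le m$ and $\mu_i=0$ for $i>m$, where $m$ is the largest index with $\lambda_m+\frac1m\sum_{k>m}\lambda_k\ge0$.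 (ii) Hermitian $\bar P_j$ with positive parts $F_j$ are replaced by $\hat P_j=S^{-1/2}F_jS^{-1/2}$, $S=\sum_jF_j$. If $\bar\rho_0$ does not have trace one, or $S$ is singular, any density operator, respectively any detector, may be returned. **Orthonormal-basis algorithm (Problem 1).** Let $I/\sqrt d,\Omega_1,\dots,\Omega_{d^2-1}$ be a Hermitian orthonormal operator basis with $\operatorname{Tr}\Omega_k=0$, and let every $\mathcal E_a$ be generalized-unital: $\mathcal E_a(I)=\alpha_aI$ with $0<\alpha_a\le1$. Let $x_{0,k}=\operatorname{Tr}(\Omega_k\rho_0)$, $C_{j,k}=\operatorname{Tr}(\Omega_kP_j)$, $C_j=(C_{j,k})_{k\ge1}$, $C_{j,0}=\operatorname{Tr}(P_j)/\sqrt d$, $x_{a,0}=\operatorname{Tr}(\rho_a)/\sqrt d$, let $E_a$ be the real matrix $(\operatorname{Tr}(\Omega_k\mathcal E_a(\Omega_l)))_{k,l\ge1}$ and $B=[\operatorname{vec}(E_1),\dots,\operatorname{vec}(E_L)]^T$. Fix one index $k_0$. 1. From relative frequencies and averages obtain: $\hat y_{aj}$ (estimate of $\operatorname{Tr}(P_j\rho_a)$)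 by applying the detector to $\rho_a$; $\hat x_{a,0}$ by measuring the operator $I$ on $\rho_a$ if $\mathcal E_a$ is not TP, and $\hat x_{a,0}=1/\sqrt d$ otherwise; $\hat C_{j,0}$ by applying the detector to $I/d$; $\bar x_{0,k_0}$ by measuring the observable $\Omega_{k_0}$ on $\rho_0$. Set $\hat Y_{aj}=\hat y_{aj}-\hat x_{a,0}\hat C_{j,0}$, $\hat Y_j=(\hat Y_{aj})_a$. 2. $\hat z_j=(B^TB)^{-1}B^T\hat Y_j$. 3. For each $j$ let $\tilde x^{(j)}\tilde C_j^T$ be the term of a largest singular value in a singular value decomposition of the matrix whose rows are the consecutive blocks of length $d^2-1$ of $\hat z_j$; put $\bar x_0^{(j)}=\frac{\bar x_{0,k_0}}{\tilde x^{(j)}_{k_0}}\tilde x^{(j)}$, $\bar C_j=\frac{\tilde x^{(j)}_{k_0}}{\bar x_{0,k_0}}\tilde C_j$. Let $\bar x_0$ be one fixed $\bar x_0^{(j)}$ or the average $\frac1M\sum_j\bar x_0^{(j)}$. 4. Apply the corrections to $\bar\rho_0=\frac Id+\sum_k\bar x_{0,k}\Omega_k$ and $\bar P_j=\hat C_{j,0}\frac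 I{\sqrt d}+\sum_k\bar C_{j,k}\Omega_k$; the results are $\hat\rho_0$ and $\{\hat P_j\}$. The total number of copies is $N=(L+L'+2)N_0$, where $L'$ is the number of processes that are not TP. **Natural-basis algorithm (Problem 2).** The processes are arbitrary; only the $\hat y_{aj}$ are measured, $N=LN_0$. With $\mathcal B=[\operatorname{vec}(\mathcal B_1),\dots,\operatorname{vec}(\mathcal B_L)]^T$ let $\hat z_j=(\mathcal B^\dagger\mathcal B)^{-1}\mathcal B^\dagger\hat y_j$, $\hat y_j=(\hat y_{aj})_a$, and let $\operatorname{vec}(\tilde\rho^{(j)})\operatorname{vec}(\tilde P_j^T)^T$ be a leading singular term of the $d^2\times d^2$ matrix rearranged from $\hat z_j$ in the same way, the factors being rescaled so that $\operatorname{Tr}\tilde\rho^{(j)}=1$. Let $\tilde\rho_0$ be one fixed $\tilde\rho^{(j)}$ or the average of all of them, $\tilde\rho_0'=(\tilde\rho_0+\tilde\rho_0^\dagger)/2$, $\bar\rho_0=\tilde\rho_0'/\operatorname{Tr}\tilde\rho_0'$, $\bar P_j=(\tilde P_j+\tilde P_j^\dagger)/2$, and apply the corrections. **Theorem.** (a)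 Let all processes be generalized-unital, $\operatorname{rank}(B)=(d^2-1)^2$ and $x_{0,k_0}\ne0$. Then the orthonormal-basis algorithm satisfies $$\mathbb E\sum_{j=1}^M\|\hat P_j-P_j\|^2=O(1/N),$$ and, if $C_j\neq0$ (that is, $P_j$ is not a multiple of $I$) for every $j$ whose $\bar x_0^{(j)}$ is used in $\bar x_0$, also $$\mathbb E\|\hat\rho_0-\rho_0\|^2=O(1/N).$$ (b) Let $\operatorname{rank}(\mathcal B)=d^4$. Then the natural-basis algorithm satisfies $\mathbb E\sum_{j}\|\hat P_j-P_j\|^2=O(1/N)$ and, if $P_j\ne0$ for every $j$ whose $\tilde\rho^{(j)}$ is used in $\tilde\rho_0$, also $\mathbb E\|\hat\rho_0-\rho_0\|^2=O(1/N)$. Here $O(1/N)$ means a bound $K/N$ for all $N_0\ge1$, where $K$ depends on $\rho_0$, the detector, the processes and (in (a)) the basis and $k_0$, but neither on $N_0$ nor on the choice of the singular value decompositions. -/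

import Mathlib

open scoped Matrix Kronecker ComplexOrder

noncomputable section

namespace SimulTomo

/-! ### States, detectors, processes -/

/-- Density operators. -/
def IsDensity {d : ℕ} (ρ : Matrix (Fin d) (Fin d) ℂ) : Prop :=
  ρ.PosSemidef ∧ ρ.trace = 1

/-- Positive-operator-valued measures with `M` outcomes. -/
def IsPOVM {d M : ℕ} (P : Fin M → Matrix (Fin d) (Fin d) ℂ) : Prop :=
  (∀ j, (P j).PosSemidef) ∧ ∑ j, P j = 1

/-- The operator sum `∑ i, A i * X * (A i)†` of the Kraus operators `A`. -/
def applyKraus {d : ℕ} (A : Fin (d ^ 2) → Matrix (Fin d) (Fin d) ℂ)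
    (X : Matrix (Fin d) (Fin d) ℂ) : Matrix (Fin d) (Fin d) ℂ :=
  ∑ i, A i * X * (A i)ᴴ

/-- Kraus operators of a (possibly trace-decreasing) quantum process: `∑ i, (A i)† * A i ≤ 1`. -/
def IsProcess {d : ℕ} (A : Fin (d ^ 2) → Matrix (Fin d) (Fin d) ℂ) : Prop :=
  (1 - ∑ i, (A i)ᴴ * A i).PosSemidef

/-- Trace-preserving processes. -/
def IsTP {d : ℕ} (A : Fin (d ^ 2) → Matrix (Fin d) (Fin d) ℂ) : Prop :=
  ∑ i, (A i)ᴴ * A i = 1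

/-- Generalized-unital processes: the identity is mapped to `α` times itself, `0 < α ≤ 1`. -/
def IsGeneralizedUnital {d : ℕ} (A : Fin (d ^ 2) → Matrix (Fin d) (Fin d) ℂ) : Prop :=
  ∃ α : ℝ, 0 < α ∧ α ≤ 1 ∧ applyKraus A 1 = (α : ℂ) • (1 : Matrix (Fin d) (Fin d) ℂ)

/-! ### Orthonormal operator basis -/

/-- The `d ^ 2 - 1` elements of an orthonormal Hermitian operator basis that are traceless;
the remaining element of the basis is `1 / √d`. -/
structure IsTracelessBasis {d : ℕ} (Ω : Fin (d ^ 2 - 1) → Matrix (Fin d) (Fin d) ℂ) : Prop where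
  herm : ∀ k, (Ω k).IsHermitian
  trace_zero : ∀ k, (Ω k).trace = 0
  orthonormal : ∀ k l, ((Ω k)ᴴ * Ω l).trace = if k = l then 1 else 0

/-- The complete basis; `none` is the index of the element `1 / √d`. -/
def fullBasis {d : ℕ} (Ω : Fin (d ^ 2 - 1) → Matrix (Fin d) (Fin d) ℂ) :
    Option (Fin (d ^ 2 - 1)) → Matrix (Fin d) (Fin d) ℂ
  | none => ((1 / Real.sqrt d : ℝ) : ℂ) • 1
  | some k => Ω k

/-- The change of basis matrix, whose rows are the conjugated vectorized basis elements. -/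
def basisChange {d : ℕ} (Ω : Fin (d ^ 2 - 1) → Matrix (Fin d) (Fin d) ℂ) :
    Matrix (Option (Fin (d ^ 2 - 1))) (Fin d × Fin d) ℂ :=
  Matrix.of fun k p => star (Matrix.vec (fullBasis Ω k) p)

/-- The coefficient of a Hermitian operator `X` at the basis element `Ω k`. -/
def coeff {d : ℕ} (Ω : Fin (d ^ 2 - 1) → Matrix (Fin d) (Fin d) ℂ)
    (X : Matrix (Fin d) (Fin d) ℂ) (k : Fin (d ^ 2 - 1)) : ℝ :=
  (Ω k * X).trace.re

/-- The matrix `∑ i, (A i)^* ⊗ A i` of a process in the natural basis. -/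
def naturalMatrix {d : ℕ} (A : Fin (d ^ 2) → Matrix (Fin d) (Fin d) ℂ) :
    Matrix (Fin d × Fin d) (Fin d × Fin d) ℂ :=
  ∑ i, (A i).map star ⊗ₖ A i

/-- The traceless block of the matrix of a process in the basis `fullBasis Ω`
(this matrix has real entries). -/
def tracelessBlock {d : ℕ} (Ω : Fin (d ^ 2 - 1) → Matrix (Fin d) (Fin d) ℂ)
    (A : Fin (d ^ 2) → Matrix (Fin d) (Fin d) ℂ) :
    Matrix (Fin (d ^ 2 - 1)) (Fin (d ^ 2 - 1)) ℝ :=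
  Matrix.of fun k l =>
    ((basisChange Ω * naturalMatrix A * (basisChange Ω)ᴴ) (some k) (some l)).re

/-- The matrix `B` of the orthonormal-basis formulation: row `a` is the vectorized traceless
block of the `a`-th process. -/
def designB {d L : ℕ} (Ω : Fin (d ^ 2 - 1) → Matrix (Fin d) (Fin d) ℂ)
    (A : Fin L → Fin (d ^ 2) → Matrix (Fin d) (Fin d) ℂ) :
    Matrix (Fin L) (Fin (d ^ 2 - 1) × Fin (d ^ 2 - 1)) ℝ :=
  Matrix.of fun a => Matrix.vec (tracelessBlock Ω (A a))

/-- The matrix `𝓑` of the natural-basis formulation. -/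
def designNatural {d L : ℕ} (A : Fin L → Fin (d ^ 2) → Matrix (Fin d) (Fin d) ℂ) :
    Matrix (Fin L) ((Fin d × Fin d) × (Fin d × Fin d)) ℂ :=
  Matrix.of fun a => Matrix.vec (naturalMatrix (A a))

/-! ### Measurement records and their probabilities (Born's rule) -/

/-- The probability of a sequence of independent outcomes with the distribution `p`. -/
def seqProb {α : Type*} {n : ℕ} (p : α → ℝ) (s : Fin n → α) : ℝ := ∏ i, p (s i)

open scoped Classical in
/-- The relative frequency of the outcome `x` in a sequence of outcomes. -/
def freq {α : Type*} {n : ℕ} (s : Fin n → α) (x : α) : ℝ :=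
  ((Finset.univ.filter fun i => s i = x).card : ℝ) / n

/-- Distribution of the outcome when the detector `P` is applied to a copy of the output of a
process. The outcome `none` is the loss of the copy; its probability is `1 - Tr σ`. -/
def detectProb {d M : ℕ} (P : Fin M → Matrix (Fin d) (Fin d) ℂ)
    (σ : Matrix (Fin d) (Fin d) ℂ) : Option (Fin M) → ℝ
  | some j => (P j * σ).trace.re
  | none => 1 - σ.trace.re

/-- Distribution of the outcome of the measurement operator `1` on the output of a process. -/
def identityProb {d : ℕ} (σ : Matrix (Fin d) (Fin d) ℂ) : Bool → ℝ
  | true => σ.trace.re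
  | false => 1 - σ.trace.re

/-- Distribution of the detector outcome on the maximally mixed state. -/
def mixedProb {d M : ℕ} (P : Fin M → Matrix (Fin d) (Fin d) ℂ) (j : Fin M) : ℝ :=
  (P j * (((1 / d : ℝ) : ℂ) • (1 : Matrix (Fin d) (Fin d) ℂ))).trace.re

/-- Distribution of the outcome of the projective measurement of the observable `O` on `ρ`:
outcome `i` is the `i`-th vector of an eigenbasis of `O`. -/
def observableProb {d : ℕ} {O : Matrix (Fin d) (Fin d) ℂ} (hO : O.IsHermitian)
    (ρ : Matrix (Fin d) (Fin d) ℂ) (i : Fin d) : ℝ :=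
  (((hO.eigenvectorUnitary : Matrix (Fin d) (Fin d) ℂ)ᴴ * ρ *
    (hO.eigenvectorUnitary : Matrix (Fin d) (Fin d) ℂ)) i i).re

/-- Detector outcomes on `N₀` copies of the output of each process. -/
abbrev OutputRecord (L M N₀ : ℕ) : Type := Fin L → Fin N₀ → Option (Fin M)

/-- All outcomes used by the orthonormal-basis algorithm, in this order: detector on the outputs
of the processes; operator `1` on the outputs of those processes that are not trace-preserving;
detector on the maximally mixed state; the observable on the unknown state. -/
abbrev FullRecord {d L : ℕ} (A : Fin L → Fin (d ^ 2) → Matrix (Fin d) (Fin d) ℂ)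
    (M N₀ : ℕ) : Type :=
  OutputRecord L M N₀ × ({a : Fin L // ¬ IsTP (A a)} → Fin N₀ → Bool) ×
    (Fin N₀ → Fin M) × (Fin N₀ → Fin d)

/-- The probability of a record of detector outcomes on the outputs of the processes. -/
def outputRecordProb {d L M N₀ : ℕ} (A : Fin L → Fin (d ^ 2) → Matrix (Fin d) (Fin d) ℂ)
    (ρ₀ : Matrix (Fin d) (Fin d) ℂ) (P : Fin M → Matrix (Fin d) (Fin d) ℂ)
    (r : OutputRecord L M N₀) : ℝ :=
  ∏ a, seqProb (detectProb P (applyKraus (A a) ρ₀)) (r a)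

open scoped Classical in
/-- The probability of a full record. -/
def fullRecordProb {d L M N₀ : ℕ} (A : Fin L → Fin (d ^ 2) → Matrix (Fin d) (Fin d) ℂ)
    (ρ₀ : Matrix (Fin d) (Fin d) ℂ) (P : Fin M → Matrix (Fin d) (Fin d) ℂ)
    {O : Matrix (Fin d) (Fin d) ℂ} (hO : O.IsHermitian) (r : FullRecord A M N₀) : ℝ :=
  outputRecordProb A ρ₀ P r.1 *
    (∏ a : {a : Fin L // ¬ IsTP (A a)},
      seqProb (identityProb (applyKraus (A a.1) ρ₀)) (r.2.1 a)) *
    seqProb (mixedProb P) r.2.2.1 * seqProb (observableProb hO ρ₀) r.2.2.2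

open scoped Classical in
/-- Expectation over all full records. -/
def fullExpectation {d L M N₀ : ℕ} (A : Fin L → Fin (d ^ 2) → Matrix (Fin d) (Fin d) ℂ)
    (ρ₀ : Matrix (Fin d) (Fin d) ℂ) (P : Fin M → Matrix (Fin d) (Fin d) ℂ)
    {O : Matrix (Fin d) (Fin d) ℂ} (hO : O.IsHermitian) (f : FullRecord A M N₀ → ℝ) : ℝ :=
  ∑ r, fullRecordProb A ρ₀ P hO r * f r

/-- Expectation over all records of detector outcomes on the outputs of the processes. -/
def outputExpectation {d L M N₀ : ℕ} (A : Fin L → Fin (d ^ 2) → Matrix (Fin d) (Fin d) ℂ)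
    (ρ₀ : Matrix (Fin d) (Fin d) ℂ) (P : Fin M → Matrix (Fin d) (Fin d) ℂ)
    (f : OutputRecord L M N₀ → ℝ) : ℝ :=
  ∑ r, outputRecordProb A ρ₀ P r * f r

open scoped Classical in
/-- Total number of state copies in a full record with `N₀` copies per experiment. It is
`(L + 2) * N₀` if all processes are trace-preserving and `(2 * L + 2) * N₀` if none is. -/
def fullCopies {d L : ℕ} (A : Fin L → Fin (d ^ 2) → Matrix (Fin d) (Fin d) ℂ) (N₀ : ℕ) : ℕ :=
  (L + Fintype.card {a : Fin L // ¬ IsTP (A a)} + 2) * N₀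

/-- Squared Frobenius norm. -/
def frobSq {d : ℕ} (X : Matrix (Fin d) (Fin d) ℂ) : ℝ := ∑ i, ∑ j, ‖X i j‖ ^ 2

/-! ### Estimates computed from the raw data -/

/-- Estimate of `Tr (P j ρ_a)`. -/
def yHat {L M N₀ : ℕ} (r : OutputRecord L M N₀) (a : Fin L) (j : Fin M) : ℝ :=
  freq (r a) (some j)

open scoped Classical in
/-- Estimate of `Tr (ρ_a) / √d`; no measurement is needed for a trace-preserving process. -/
def xHatZero {d L M N₀ : ℕ} {A : Fin L → Fin (d ^ 2) → Matrix (Fin d) (Fin d) ℂ}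
    (r : FullRecord A M N₀) (a : Fin L) : ℝ :=
  if h : IsTP (A a) then 1 / Real.sqrt d else freq (r.2.1 ⟨a, h⟩) true / Real.sqrt d

/-- Estimate of the coefficient `Tr (P j) / √d` of `P j` at the basis element `1 / √d`. -/
def cHatZero {d L M N₀ : ℕ} {A : Fin L → Fin (d ^ 2) → Matrix (Fin d) (Fin d) ℂ}
    (r : FullRecord A M N₀) (j : Fin M) : ℝ :=
  Real.sqrt d * freq r.2.2.1 j

/-- Estimate of the mean value of the observable in the unknown state: the average of the
observed eigenvalues. -/
def observableMean {d L M N₀ : ℕ} {A : Fin L → Fin (d ^ 2) → Matrix (Fin d) (Fin d) ℂ}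
    {O : Matrix (Fin d) (Fin d) ℂ} (hO : O.IsHermitian) (r : FullRecord A M N₀) : ℝ :=
  (∑ i, hO.eigenvalues (r.2.2.2 i)) / N₀

/-- The data vector of outcome `j` with the contribution of the traces removed. -/
def YHat {d L M N₀ : ℕ} {A : Fin L → Fin (d ^ 2) → Matrix (Fin d) (Fin d) ℂ}
    (r : FullRecord A M N₀) (j : Fin M) (a : Fin L) : ℝ :=
  yHat r.1 a j - xHatZero r a * cHatZero r j

/-! ### Least squares and nearest Kronecker product -/

/-- The least squares solution `(B† B)⁻¹ B† Y`. -/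
def leastSquares {𝕜 : Type*} [RCLike 𝕜] {m n : Type*} [Fintype m] [Fintype n] [DecidableEq n]
    (B : Matrix m n 𝕜) (Y : m → 𝕜) : n → 𝕜 :=
  (Bᴴ * B)⁻¹ *ᵥ (Bᴴ *ᵥ Y)

/-- `T = U * Σ * V†` is a singular value decomposition (in any order of the singular values). -/
def IsSVD {𝕜 : Type*} [RCLike 𝕜] {n : Type*} [Fintype n] [DecidableEq n]
    (T U : Matrix n n 𝕜) (s : n → ℝ) (V : Matrix n n 𝕜) : Prop :=
  U ∈ Matrix.unitaryGroup n 𝕜 ∧ V ∈ Matrix.unitaryGroup n 𝕜 ∧ (∀ i, 0 ≤ s i) ∧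
    T = U * Matrix.diagonal (fun i => (s i : 𝕜)) * Vᴴ

/-- `x` and `c` are Kronecker factors of `z` found by the singular value decomposition: `z` is
rearranged into the matrix `T` with `T k l = z (k, l)`, and `x cᵀ` is the term of a largest
singular value of `T`. The factors are determined up to `(q x, c / q)` only. -/
def IsSVDFactor {𝕜 : Type*} [RCLike 𝕜] {n : Type*} [Fintype n] [DecidableEq n]
    (z : n × n → 𝕜) (x c : n → 𝕜) : Prop :=
  ∃ (U : Matrix n n 𝕜) (s : n → ℝ) (V : Matrix n n 𝕜) (i₀ : n),
    IsSVD (Matrix.of fun k l => z (k, l)) U s V ∧ (∀ i, s i ≤ s i₀) ∧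
      ∀ k l, x k * c l = (s i₀ : 𝕜) * U k i₀ * star (V l i₀)

/-- The two ways to obtain one estimate of the state from the `M` estimates, one per outcome. -/
inductive StateChoice (M : ℕ) : Type
  | single (j : Fin M)
  | average

/-- The outcomes whose state estimates are used. -/
def StateChoice.Uses {M : ℕ} : StateChoice M → Fin M → Prop
  | .single j, i => i = j
  | .average, _ => True

/-- The estimate chosen from the `M` estimates. -/
def StateChoice.combine {M : ℕ} {E : Type*} [AddCommGroup E] [Module ℝ E] :
    StateChoice M → (Fin M → E) → E
  | .single j, v => v j
  | .average, v => ((1 / M : ℝ)) • ∑ j, v j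

/-! ### Physical corrections -/

/-- The fast correction of a real sequence `lam` in decreasing order with sum `1` to a probability
vector `mu`: going from the smallest entry up, an entry is set to zero, and its value is spread
evenly over the entries before it, as long as the corrected entry is negative. Here `m` is the
last entry that is kept. -/
def IsFastCorrection {d : ℕ} (lam mu : Fin d → ℝ) : Prop :=
  ∃ m : Fin d,
    0 ≤ lam m + (∑ k ∈ Finset.Ioi m, lam k) / ((m : ℕ) + 1 : ℝ) ∧
    (∀ i, m < i → lam i + (∑ k ∈ Finset.Ioi i, lam k) / ((i : ℕ) + 1 : ℝ) < 0) ∧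
    ∀ i, mu i =
      if i ≤ m then lam i + (∑ k ∈ Finset.Ioi m, lam k) / ((m : ℕ) + 1 : ℝ) else 0

/-- `ρh` is the density operator obtained from the Hermitian operator `ρb` of trace one by the
fast correction of its eigenvalues. If `ρb` does not have trace one (which happens only if an
earlier normalization was impossible), any density operator may be returned. -/
def IsStateCorrection {d : ℕ} (ρb ρh : Matrix (Fin d) (Fin d) ℂ) : Prop :=
  IsDensity ρh ∧
    (ρb.trace = 1 →
      ∃ (V : Matrix (Fin d) (Fin d) ℂ) (lam mu : Fin d → ℝ),
        V ∈ Matrix.unitaryGroup (Fin d) ℂ ∧ Antitone lam ∧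
        ρb = V * Matrix.diagonal (fun i => (lam i : ℂ)) * Vᴴ ∧
        IsFastCorrection lam mu ∧
        ρh = V * Matrix.diagonal (fun i => (mu i : ℂ)) * Vᴴ)

/-- `F` is the positive part of the Hermitian matrix `X`. -/
def IsPositivePart {d : ℕ} (X F : Matrix (Fin d) (Fin d) ℂ) : Prop :=
  ∃ (V : Matrix (Fin d) (Fin d) ℂ) (lam : Fin d → ℝ),
    V ∈ Matrix.unitaryGroup (Fin d) ℂ ∧
    X = V * Matrix.diagonal (fun i => (lam i : ℂ)) * Vᴴ ∧
    F = V * Matrix.diagonal (fun i => ((max (lam i) 0 : ℝ) : ℂ)) * Vᴴ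

/-- `Ph` is the detector obtained from the Hermitian matrices `Pb`: with the positive parts `F j`
and `S = ∑ j, F j`, one takes `S^(-1/2) * F j * S^(-1/2)`. If `S` is singular, any detector may
be returned. -/
def IsDetectorCorrection {d M : ℕ} (Pb Ph : Fin M → Matrix (Fin d) (Fin d) ℂ) : Prop :=
  IsPOVM Ph ∧
    ∃ F : Fin M → Matrix (Fin d) (Fin d) ℂ, (∀ j, IsPositivePart (Pb j) (F j)) ∧
      (IsUnit (∑ j, F j).det →
        ∃ R : Matrix (Fin d) (Fin d) ℂ, R.PosSemidef ∧ R * R = ∑ j, F j ∧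
          ∀ j, Ph j = R⁻¹ * F j * R⁻¹)

/-! ### The two closed-form algorithms -/

/-- `(ρh, Ph)` is an output of the closed-form algorithm in the orthonormal basis on the record
`r`, where the coefficient of the state at `Ω k₀` is the one that was measured. A quotient with
denominator zero is read as zero. -/
def IsOrthonormalOutput {d L M N₀ : ℕ} {Ω : Fin (d ^ 2 - 1) → Matrix (Fin d) (Fin d) ℂ}
    (hΩ : IsTracelessBasis Ω) (k₀ : Fin (d ^ 2 - 1))
    (A : Fin L → Fin (d ^ 2) → Matrix (Fin d) (Fin d) ℂ) (ch : StateChoice M)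
    (r : FullRecord A M N₀)
    (ρh : Matrix (Fin d) (Fin d) ℂ) (Ph : Fin M → Matrix (Fin d) (Fin d) ℂ) : Prop :=
  ∃ xt ct : Fin M → Fin (d ^ 2 - 1) → ℝ,
    (∀ j, IsSVDFactor (leastSquares (designB Ω A) (YHat r j)) (xt j) (ct j)) ∧
    ∃ (xb : Fin (d ^ 2 - 1) → ℝ) (cb : Fin M → Fin (d ^ 2 - 1) → ℝ),
      xb = ch.combine (fun j => (observableMean (hΩ.herm k₀) r / xt j k₀) • xt j) ∧
      (∀ j, cb j = (xt j k₀ / observableMean (hΩ.herm k₀) r) • ct j) ∧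
      IsStateCorrection
        (((1 / Real.sqrt d : ℝ) : ℂ) • fullBasis Ω none + ∑ k, (xb k : ℂ) • Ω k) ρh ∧
      IsDetectorCorrection
        (fun j => (cHatZero r j : ℂ) • fullBasis Ω none + ∑ k, (cb j k : ℂ) • Ω k) Ph

/-- `(ρh, Ph)` is an output of the closed-form algorithm in the natural basis on the record `r`.
The free factor in the Kronecker factors of each outcome is fixed by giving the state factor trace
one. A quotient with denominator zero is read as zero. -/
def IsNaturalOutput {d L M N₀ : ℕ}
    (A : Fin L → Fin (d ^ 2) → Matrix (Fin d) (Fin d) ℂ) (ch : StateChoice M)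
    (r : OutputRecord L M N₀)
    (ρh : Matrix (Fin d) (Fin d) ℂ) (Ph : Fin M → Matrix (Fin d) (Fin d) ℂ) : Prop :=
  ∃ ρs Ps : Fin M → Matrix (Fin d) (Fin d) ℂ,
    (∀ j, IsSVDFactor (leastSquares (designNatural A) (fun a => (yHat r a j : ℂ)))
      (Matrix.vec (ρs j)) (Matrix.vec (Ps j)ᵀ)) ∧
    ∃ (ρt ρ' : Matrix (Fin d) (Fin d) ℂ) (Pt : Fin M → Matrix (Fin d) (Fin d) ℂ),
      ρt = ch.combine (fun j => (ρs j).trace⁻¹ • ρs j) ∧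
      (∀ j, Pt j = (ρs j).trace • Ps j) ∧
      ρ' = (1 / 2 : ℂ) • (ρt + ρtᴴ) ∧
      IsStateCorrection (ρ'.trace⁻¹ • ρ') ρh ∧
      IsDetectorCorrection (fun j => (1 / 2 : ℂ) • (Pt j + (Pt j)ᴴ)) Ph

end SimulTomo

end

/-!
A leading singular term of a matrix is one of its best rank-one approximations, so it is at most
twice as far from the exact Kronecker product as the least squares solution, whose error is linear
in the error of the data. The unknown scale of the two factors cancels in the rescaled estimates
wherever the normalizing coordinate of the exact factor is nonzero. The fast correction is the
nearest-point projection onto the density operators, hence does not increase the distance to `ρ₀`,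
and the detector correction is Lipschitz near a detector, where `S` is close to `1`. Therefore the
estimates deviate by `O(√err)` as the squared data error `err` tends to zero; since states and
detectors are bounded, their squared deviation is at most `K * err` for all data. The mean of `err`
is a sum of variances of relative frequencies, which is `O(1 / N₀)`.
-/

namespace SimulTomo

open scoped Matrix.Norms.Frobenius

/-! ### The Frobenius norm -/

section Frobenius

variable {𝕜 : Type*} [RCLike 𝕜] {m n : Type*} [Fintype m] [Fintype n]

theorem frobenius_norm_sq (X : Matrix m n 𝕜) : ‖X‖ ^ 2 = ∑ i, ∑ j, ‖X i j‖ ^ 2 := by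
  rw [Matrix.frobenius_norm_def, ← Real.sqrt_eq_rpow, Real.sq_sqrt (by positivity)]
  simp only [Real.rpow_ofNat]

theorem frobSq_eq_norm_sq {d : ℕ} (X : Matrix (Fin d) (Fin d) ℂ) : frobSq X = ‖X‖ ^ 2 :=
  (frobenius_norm_sq X).symm

theorem frobenius_norm_sq_eq_trace (X : Matrix m n 𝕜) :
    ‖X‖ ^ 2 = RCLike.re (Xᴴ * X).trace := by
  rw [frobenius_norm_sq, Finset.sum_comm]
  simp only [Matrix.trace, Matrix.diag_apply, Matrix.mul_apply, Matrix.conjTranspose_apply,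
    RCLike.star_def, RCLike.conj_mul, ← RCLike.ofReal_pow, map_sum, RCLike.ofReal_re]

theorem frobenius_norm_add_sq (X Y : Matrix m n 𝕜) :
    ‖X + Y‖ ^ 2 = ‖X‖ ^ 2 + ‖Y‖ ^ 2 + 2 * RCLike.re (Xᴴ * Y).trace := by
  have symm : RCLike.re (Yᴴ * X).trace = RCLike.re (Xᴴ * Y).trace := by
    rw [← Matrix.conjTranspose_conjTranspose X, ← Matrix.conjTranspose_mul,
      Matrix.trace_conjTranspose, Matrix.conjTranspose_conjTranspose, RCLike.star_def,
      RCLike.conj_re]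
  simp only [frobenius_norm_sq_eq_trace, Matrix.conjTranspose_add, Matrix.add_mul,
    Matrix.mul_add, Matrix.trace_add, map_add, symm]
  ring

theorem frobenius_norm_unitary_mul [DecidableEq m] {U : Matrix m m 𝕜}
    (hU : U ∈ Matrix.unitaryGroup m 𝕜) (X : Matrix m n 𝕜) : ‖U * X‖ = ‖X‖ := by
  have hUU : Uᴴ * U = 1 := Matrix.mem_unitaryGroup_iff'.1 hU
  refine (pow_left_inj₀ (norm_nonneg _) (norm_nonneg _) two_ne_zero).1 ?_
  rw [frobenius_norm_sq_eq_trace, frobenius_norm_sq_eq_trace, Matrix.conjTranspose_mul,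
    Matrix.mul_assoc, ← Matrix.mul_assoc Uᴴ, hUU, Matrix.one_mul]

theorem frobenius_norm_unitary_mul_mul [DecidableEq m] [DecidableEq n] {U : Matrix m m 𝕜}
    {V : Matrix n n 𝕜} (hU : U ∈ Matrix.unitaryGroup m 𝕜) (hV : V ∈ Matrix.unitaryGroup n 𝕜)
    (X : Matrix m n 𝕜) : ‖U * X * Vᴴ‖ = ‖X‖ := by
  rw [← Matrix.frobenius_norm_conjTranspose, Matrix.conjTranspose_mul,
    Matrix.conjTranspose_conjTranspose, frobenius_norm_unitary_mul hV,
    Matrix.frobenius_norm_conjTranspose, frobenius_norm_unitary_mul hU]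

theorem frobenius_norm_vecMulVec (a : m → 𝕜) (b : n → 𝕜) :
    ‖Matrix.vecMulVec a b‖ = ‖WithLp.toLp 2 a‖ * ‖WithLp.toLp 2 b‖ := by
  refine (pow_left_inj₀ (norm_nonneg _) (by positivity) two_ne_zero).1 ?_
  simp only [frobenius_norm_sq, Matrix.vecMulVec_apply, norm_mul, mul_pow,
    EuclideanSpace.norm_sq_eq, Finset.sum_mul_sum]

end Frobenius

/-! ### The leading singular term -/

section LeadingTerm

variable {𝕜 : Type*} [RCLike 𝕜] {n : Type*} [Fintype n] [DecidableEq n]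

theorem re_trace_diagonal_mul_vecMulVec_le {s : n → ℝ} (hs : ∀ i, 0 ≤ s i) {i₀ : n}
    (hmax : ∀ i, s i ≤ s i₀) (a b : n → 𝕜) :
    RCLike.re (Matrix.diagonal (fun i => (s i : 𝕜)) * Matrix.vecMulVec a b).trace ≤
      s i₀ * ‖Matrix.vecMulVec a b‖ := by
  calc RCLike.re (Matrix.diagonal (fun i => (s i : 𝕜)) * Matrix.vecMulVec a b).trace
      = ∑ i, s i * RCLike.re (a i * b i) := by
        simp only [Matrix.trace, Matrix.diag_apply, Matrix.diagonal_mul, Matrix.vecMulVec_apply,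
          map_sum, RCLike.re_ofReal_mul]
    _ ≤ ∑ i, s i₀ * (‖a i‖ * ‖b i‖) := by
        refine Finset.sum_le_sum fun i _ => ?_
        rw [← norm_mul]
        exact (mul_le_mul_of_nonneg_left (RCLike.re_le_norm _) (hs i)).trans
          (mul_le_mul_of_nonneg_right (hmax i) (norm_nonneg _))
    _ = s i₀ * ∑ i, ‖a i‖ * ‖b i‖ := (Finset.mul_sum ..).symm
    _ ≤ s i₀ * ‖Matrix.vecMulVec a b‖ := by
        rw [frobenius_norm_vecMulVec, EuclideanSpace.norm_eq, EuclideanSpace.norm_eq]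
        gcongr
        · exact hs i₀
        · exact Real.sum_mul_le_sqrt_mul_sqrt ..

theorem norm_diagonal_sub_single_le {s : n → ℝ} (hs : ∀ i, 0 ≤ s i) {i₀ : n}
    (hmax : ∀ i, s i ≤ s i₀) (a b : n → 𝕜) :
    ‖Matrix.diagonal (fun i => (s i : 𝕜)) - Matrix.diagonal (Pi.single i₀ (s i₀ : 𝕜))‖ ≤
      ‖Matrix.diagonal (fun i => (s i : 𝕜)) - Matrix.vecMulVec a b‖ := by
  set D := Matrix.diagonal fun i => (s i : 𝕜)
  have residual : ‖D - Matrix.diagonal (Pi.single i₀ (s i₀ : 𝕜))‖ ^ 2 + s i₀ ^ 2 = ‖D‖ ^ 2 := by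
    rw [Matrix.diagonal_sub, Matrix.frobenius_norm_diagonal, Matrix.frobenius_norm_diagonal,
      EuclideanSpace.norm_sq_eq, EuclideanSpace.norm_sq_eq,
      ← Finset.sum_erase_add _ _ (Finset.mem_univ i₀),
      ← Finset.sum_erase_add _ (fun i => ‖(s i : 𝕜)‖ ^ 2) (Finset.mem_univ i₀)]
    congr 1
    · simp only [Pi.single_eq_same, sub_self, norm_zero, zero_pow two_ne_zero, add_zero]
      refine Finset.sum_congr rfl fun i hi => ?_
      rw [Pi.single_eq_of_ne (Finset.ne_of_mem_erase hi), sub_zero]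
    · rw [RCLike.norm_ofReal, sq_abs]
  have expand := frobenius_norm_add_sq D (-Matrix.vecMulVec a b)
  have hD : Dᴴ = D := Matrix.isHermitian_diagonal_of_self_adjoint _ (by ext i; simp)
  rw [← sub_eq_add_neg, norm_neg, Matrix.mul_neg, Matrix.trace_neg, map_neg, hD] at expand
  refine le_of_sq_le_sq ?_ (norm_nonneg _)
  nlinarith [sq_nonneg (‖Matrix.vecMulVec a b‖ - s i₀),
    re_trace_diagonal_mul_vecMulVec_le hs hmax a b]

theorem IsSVDFactor.norm_sub_le {z : n × n → 𝕜} {x c : n → 𝕜} (h : IsSVDFactor z x c)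
    (a b : n → 𝕜) :
    ‖Matrix.of (fun k l => z (k, l)) - Matrix.vecMulVec x c‖ ≤
      ‖Matrix.of (fun k l => z (k, l)) - Matrix.vecMulVec a b‖ := by
  obtain ⟨U, s, V, i₀, ⟨hU, hV, hs, hT⟩, hmax, hxc⟩ := h
  have hUU : U * Uᴴ = 1 := Matrix.mem_unitaryGroup_iff.1 hU
  have hVV : V * Vᴴ = 1 := Matrix.mem_unitaryGroup_iff.1 hV
  have leading : Matrix.vecMulVec x c =
      U * Matrix.diagonal (Pi.single i₀ (s i₀ : 𝕜)) * Vᴴ := by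
    ext k l
    rw [Matrix.vecMulVec_apply, hxc, Matrix.mul_apply, Finset.sum_eq_single i₀]
    · rw [Matrix.mul_diagonal, Pi.single_eq_same, Matrix.conjTranspose_apply, mul_comm (U k i₀)]
    · intro i _ hi
      rw [Matrix.mul_diagonal, Pi.single_eq_of_ne hi, mul_zero, zero_mul]
    · simp
  have competitor : Matrix.vecMulVec a b =
      U * Matrix.vecMulVec (Uᴴ *ᵥ a) (b ᵥ* V) * Vᴴ := by
    rw [Matrix.mul_vecMulVec, Matrix.vecMulVec_mul, Matrix.mulVec_mulVec, Matrix.vecMul_vecMul,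
      hUU, hVV, Matrix.one_mulVec, Matrix.vecMul_one]
  rw [hT, leading, competitor]
  simp only [← Matrix.sub_mul, ← Matrix.mul_sub]
  rw [frobenius_norm_unitary_mul_mul hU hV, frobenius_norm_unitary_mul_mul hU hV]
  exact norm_diagonal_sub_single_le hs hmax _ _

theorem IsSVDFactor.norm_vecMulVec_sub_le {z : n × n → 𝕜} {x c : n → 𝕜}
    (h : IsSVDFactor z x c) (a b : n → 𝕜) :
    ‖Matrix.vecMulVec x c - Matrix.vecMulVec a b‖ ≤
      2 * ‖Matrix.of (fun k l => z (k, l)) - Matrix.vecMulVec a b‖ := by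
  have triangle := norm_sub_le_norm_sub_add_norm_sub (Matrix.vecMulVec x c)
    (Matrix.of (fun k l => z (k, l))) (Matrix.vecMulVec a b)
  rw [norm_sub_rev (Matrix.vecMulVec x c) (Matrix.of _)] at triangle
  linarith [h.norm_sub_le a b]

end LeadingTerm

/-! ### Physical corrections -/

section SpectralMatrix

variable {n : Type*} [Fintype n]

theorem re_diag_conj_nonneg {σ : Matrix n n ℂ} (hσ : σ.PosSemidef) (V : Matrix n n ℂ) (i : n) :
    0 ≤ ((Vᴴ * σ * V) i i).re :=
  (Complex.le_def.1 (hσ.conjTranspose_mul_mul_same V).diag_nonneg).1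

variable [DecidableEq n]

/-- The matrix with eigenvectors the columns of `V` and real eigenvalues `w`, when `V` is unitary.
Both corrections change `w` only. -/
noncomputable def spectralMatrix (V : Matrix n n ℂ) (w : n → ℝ) : Matrix n n ℂ :=
  V * Matrix.diagonal (fun i => (w i : ℂ)) * Vᴴ

theorem eq_spectralMatrix_of_isHermitian {X : Matrix n n ℂ} (hX : X.IsHermitian) :
    X = spectralMatrix hX.eigenvectorUnitary hX.eigenvalues :=
  (hX.spectral_theorem).trans (Unitary.conjStarAlgAut_apply ..)

theorem spectralMatrix_sub (V : Matrix n n ℂ) (w v : n → ℝ) :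
    spectralMatrix V w - spectralMatrix V v = spectralMatrix V (w - v) := by
  simp only [spectralMatrix, ← Matrix.sub_mul, ← Matrix.mul_sub, Matrix.diagonal_sub,
    Pi.sub_apply, Complex.ofReal_sub]

theorem isHermitian_spectralMatrix (V : Matrix n n ℂ) (w : n → ℝ) :
    (spectralMatrix V w).IsHermitian :=
  Matrix.isHermitian_mul_mul_conjTranspose V <|
    Matrix.isHermitian_diagonal_of_self_adjoint _ <| funext fun _ => Complex.conj_ofReal _

theorem conjTranspose_mul_spectralMatrix_mul {V : Matrix n n ℂ} (hV : V ∈ Matrix.unitaryGroup n ℂ)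
    (w : n → ℝ) : Vᴴ * spectralMatrix V w * V = Matrix.diagonal fun i => (w i : ℂ) := by
  have hVV : Vᴴ * V = 1 := Matrix.mem_unitaryGroup_iff'.1 hV
  rw [spectralMatrix, ← Matrix.mul_assoc, ← Matrix.mul_assoc, hVV, Matrix.one_mul,
    Matrix.mul_assoc, hVV, Matrix.mul_one]

theorem re_trace_spectralMatrix_mul (V σ : Matrix n n ℂ) (w : n → ℝ) :
    (spectralMatrix V w * σ).trace.re = ∑ i, w i * ((Vᴴ * σ * V) i i).re := by
  rw [spectralMatrix, Matrix.mul_assoc, Matrix.mul_assoc, Matrix.trace_mul_comm, Matrix.mul_assoc]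
  simp only [Matrix.trace, Matrix.diag_apply, Matrix.diagonal_mul, Complex.re_sum,
    Complex.re_ofReal_mul]

theorem trace_spectralMatrix {V : Matrix n n ℂ} (hV : V ∈ Matrix.unitaryGroup n ℂ) (w : n → ℝ) :
    (spectralMatrix V w).trace = ∑ i, (w i : ℂ) := by
  have hVV : Vᴴ * V = 1 := Matrix.mem_unitaryGroup_iff'.1 hV
  rw [spectralMatrix, Matrix.trace_mul_comm, ← Matrix.mul_assoc, hVV, Matrix.one_mul,
    Matrix.trace_diagonal]

theorem norm_spectralMatrix {V : Matrix n n ℂ} (hV : V ∈ Matrix.unitaryGroup n ℂ) (w : n → ℝ) :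
    ‖spectralMatrix V w‖ = ‖WithLp.toLp 2 w‖ := by
  rw [spectralMatrix, frobenius_norm_unitary_mul_mul hV hV, Matrix.frobenius_norm_diagonal,
    EuclideanSpace.norm_eq, EuclideanSpace.norm_eq]
  simp only [Complex.norm_real]

theorem sum_re_diag_conj {V : Matrix n n ℂ} (hV : V ∈ Matrix.unitaryGroup n ℂ)
    (σ : Matrix n n ℂ) : ∑ i, ((Vᴴ * σ * V) i i).re = σ.trace.re := by
  have hVV : V * Vᴴ = 1 := Matrix.mem_unitaryGroup_iff.1 hV
  have htrace : (Vᴴ * σ * V).trace = σ.trace := by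
    rw [Matrix.mul_assoc, Matrix.trace_mul_comm, Matrix.mul_assoc, hVV, Matrix.mul_one]
  rw [← htrace, Matrix.trace, Complex.re_sum]
  rfl

-- The hypothesis is the variational inequality of the projection onto a convex set.
theorem norm_spectralMatrix_sub_le {V : Matrix n n ℂ} (hV : V ∈ Matrix.unitaryGroup n ℂ)
    {w v : n → ℝ} {σ : Matrix n n ℂ}
    (h : ∑ i, (w i - v i) * (((Vᴴ * σ * V) i i).re - v i) ≤ 0) :
    ‖spectralMatrix V v - σ‖ ≤ ‖spectralMatrix V w - σ‖ := by
  have cross : ((spectralMatrix V (w - v))ᴴ * (spectralMatrix V v - σ)).trace.re =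
      -∑ i, (w i - v i) * (((Vᴴ * σ * V) i i).re - v i) := by
    rw [(isHermitian_spectralMatrix V _).eq, re_trace_spectralMatrix_mul, ← Finset.sum_neg_distrib]
    refine Finset.sum_congr rfl fun i _ => ?_
    rw [Matrix.mul_sub, Matrix.sub_mul, conjTranspose_mul_spectralMatrix_mul hV,
      Matrix.sub_apply, Matrix.diagonal_apply_eq, Complex.sub_re, Complex.ofReal_re, Pi.sub_apply]
    ring
  have expand := frobenius_norm_add_sq (spectralMatrix V (w - v)) (spectralMatrix V v - σ)
  rw [← spectralMatrix_sub, sub_add_sub_cancel, spectralMatrix_sub, RCLike.re_eq_complex_re,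
    cross] at expand
  refine le_of_sq_le_sq ?_ (norm_nonneg _)
  nlinarith [sq_nonneg ‖spectralMatrix V (w - v)‖]

theorem norm_le_re_trace {X : Matrix n n ℂ} (hX : X.PosSemidef) : ‖X‖ ≤ X.trace.re := by
  have hU := hX.1.eigenvectorUnitary.2
  have htrace : X.trace.re = ∑ i, hX.1.eigenvalues i := by
    rw [hX.1.trace_eq_sum_eigenvalues]
    simp
  have hnorm : ‖X‖ = ‖WithLp.toLp 2 hX.1.eigenvalues‖ := by
    conv_lhs => rw [eq_spectralMatrix_of_isHermitian hX.1]
    exact norm_spectralMatrix hU _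
  rw [htrace, hnorm, EuclideanSpace.norm_eq]
  refine Real.sqrt_le_iff.2 ⟨Finset.sum_nonneg fun i _ => hX.eigenvalues_nonneg i, ?_⟩
  simpa only [Real.norm_eq_abs, sq_abs] using
    Finset.sum_sq_le_sq_sum_of_nonneg fun i _ => hX.eigenvalues_nonneg i

end SpectralMatrix

section Corrections

variable {d : ℕ}

theorem IsPositivePart.norm_sub_le {X F σ : Matrix (Fin d) (Fin d) ℂ} (h : IsPositivePart X F)
    (hσ : σ.PosSemidef) : ‖F - σ‖ ≤ ‖X - σ‖ := by
  obtain ⟨V, lam, hV, rfl, rfl⟩ := h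
  refine norm_spectralMatrix_sub_le hV (Finset.sum_nonpos fun i _ => ?_)
  have hq := re_diag_conj_nonneg hσ V i
  rcases le_total (lam i) 0 with hi | hi
  · rw [max_eq_right hi]
    nlinarith
  · rw [max_eq_left hi, sub_self, zero_mul]

-- These are the optimality conditions of the projection onto the probability simplex, with `-τ`
-- as the multiplier of the constraint on the sum.
theorem IsFastCorrection.exists_multiplier {lam mu : Fin d → ℝ} (h : IsFastCorrection lam mu)
    (hlam : Antitone lam) :
    ∃ τ : ℝ, ∀ i, lam i - mu i + τ ≤ 0 ∧ (lam i - mu i + τ) * mu i = 0 := by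
  obtain ⟨m, -, hdropped, hmu⟩ := h
  set τ := (∑ k ∈ Finset.Ioi m, lam k) / ((m : ℕ) + 1 : ℝ) with hτ
  refine ⟨τ, fun i => ?_⟩
  rw [hmu]
  split_ifs with hi
  · exact ⟨by linarith, by ring⟩
  refine ⟨?_, mul_zero _⟩
  rw [not_le] at hi
  obtain ⟨m', hm'⟩ : ∃ m' : Fin d, (m' : ℕ) = m + 1 := ⟨⟨m + 1, lt_of_le_of_lt hi i.isLt⟩, rfl⟩
  have hsum : ∑ k ∈ Finset.Ioi m, lam k = lam m' + ∑ k ∈ Finset.Ioi m', lam k := by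
    rw [← Finset.sum_insert (by simp)]
    congr 1
    ext k
    simp only [Finset.mem_Ioi, Finset.mem_insert, Fin.lt_def, Fin.ext_iff]
    omega
  have hnext : lam m' * ((m : ℕ) + 1 + 1 : ℝ) + ∑ k ∈ Finset.Ioi m', lam k < 0 := by
    have hpos : (0 : ℝ) < (m : ℕ) + 1 + 1 := by positivity
    have h := hdropped m' (Fin.lt_def.2 (by omega))
    rw [hm', Nat.cast_add_one] at h
    have h' := mul_neg_of_neg_of_pos h hpos
    rwa [add_mul, div_mul_cancel₀ _ hpos.ne'] at h'
  have hm'τ : lam m' + τ < 0 := by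
    have hpos : (0 : ℝ) < (m : ℕ) + 1 := by positivity
    refine neg_of_mul_neg_left ?_ hpos.le
    rw [add_mul, hτ, div_mul_cancel₀ _ hpos.ne', hsum]
    linarith
  have hle : lam i ≤ lam m' := hlam (Fin.le_def.2 (by rw [hm']; exact hi))
  linarith

theorem IsStateCorrection.norm_sub_le {ρb ρh σ : Matrix (Fin d) (Fin d) ℂ}
    (h : IsStateCorrection ρb ρh) (htr : ρb.trace = 1) (hσ : IsDensity σ) :
    ‖ρh - σ‖ ≤ ‖ρb - σ‖ := by
  obtain ⟨⟨-, hρh⟩, hcor⟩ := h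
  obtain ⟨V, lam, mu, hV, hanti, rfl, hfast, rfl⟩ := hcor htr
  obtain ⟨τ, hτ⟩ := hfast.exists_multiplier hanti
  refine norm_spectralMatrix_sub_le hV ?_
  set q := fun i => ((Vᴴ * σ * V) i i).re
  have hmu : ∑ i, mu i = 1 := by
    exact_mod_cast (trace_spectralMatrix hV mu).symm.trans hρh
  have hq : ∑ i, q i = 1 := by rw [sum_re_diag_conj hV, hσ.2, Complex.one_re]
  calc ∑ i, (lam i - mu i) * (q i - mu i)
      = ∑ i, (lam i - mu i + τ) * (q i - mu i) - τ * (∑ i, q i - ∑ i, mu i) := by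
        rw [← Finset.sum_sub_distrib, Finset.mul_sum, ← Finset.sum_sub_distrib]
        exact Finset.sum_congr rfl fun i _ => by ring
    _ = ∑ i, (lam i - mu i + τ) * q i := by
        rw [hq, hmu, sub_self, mul_zero, sub_zero]
        exact Finset.sum_congr rfl fun i _ => by rw [mul_sub, (hτ i).2, sub_zero]
    _ ≤ 0 := Finset.sum_nonpos fun i _ =>
        mul_nonpos_of_nonpos_of_nonneg (hτ i).1 (re_diag_conj_nonneg hσ.1 V i)

theorem IsDensity.norm_le_one {ρ : Matrix (Fin d) (Fin d) ℂ} (h : IsDensity ρ) : ‖ρ‖ ≤ 1 := by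
  simpa only [h.2, Complex.one_re] using norm_le_re_trace h.1

theorem IsPOVM.norm_le {M : ℕ} {P : Fin M → Matrix (Fin d) (Fin d) ℂ} (h : IsPOVM P)
    (j : Fin M) : ‖P j‖ ≤ d := by
  calc ‖P j‖ ≤ (P j).trace.re := norm_le_re_trace (h.1 j)
    _ ≤ ∑ i, (P i).trace.re :=
      Finset.single_le_sum (f := fun i => (P i).trace.re)
        (fun i _ => (Complex.le_def.1 (h.1 i).trace_nonneg).1) (Finset.mem_univ j)
    _ = d := by
      rw [← Complex.re_sum, ← Matrix.trace_sum, h.2, Matrix.trace_one, Fintype.card_fin,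
        Complex.natCast_re]

theorem norm_sub_one_le_norm_mul_self_sub_one {n : Type*} [Fintype n] [DecidableEq n]
    {R : Matrix n n ℂ} (hR : R.PosSemidef) : ‖R - 1‖ ≤ ‖R * R - 1‖ := by
  have factor : R * R - 1 = (R - 1) + R * (R - 1) := by noncomm_ring
  have cross : 0 ≤ ((R - 1)ᴴ * (R * (R - 1))).trace.re := by
    rw [← Matrix.mul_assoc]
    exact (Complex.le_def.1 (hR.conjTranspose_mul_mul_same (R - 1)).trace_nonneg).1
  refine le_of_sq_le_sq ?_ (norm_nonneg _)
  rw [factor, frobenius_norm_add_sq, RCLike.re_eq_complex_re]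
  nlinarith [sq_nonneg ‖R * (R - 1)‖]

theorem isUnit_of_norm_sub_one_lt {n : Type*} [Fintype n] [DecidableEq n] {S : Matrix n n ℂ}
    (h : ‖S - 1‖ < 1) : IsUnit S := by
  rw [norm_sub_rev] at h
  simpa only [sub_sub_cancel] using isUnit_one_sub_of_norm_lt_one h

theorem norm_sub_mul_mul_le {n : Type*} [Fintype n] [DecidableEq n] (Q R : Matrix n n ℂ) :
    ‖Q - R * Q * R‖ ≤ (1 + ‖R‖) * ‖Q‖ * ‖R - 1‖ := by
  have split : Q - R * Q * R = -((R - 1) * Q + R * Q * (R - 1)) := by noncomm_ring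
  calc ‖Q - R * Q * R‖ ≤ ‖(R - 1) * Q‖ + ‖R * Q * (R - 1)‖ := by
        rw [split, norm_neg]
        exact norm_add_le _ _
    _ ≤ ‖R - 1‖ * ‖Q‖ + ‖R‖ * ‖Q‖ * ‖R - 1‖ := by
        gcongr
        · exact norm_mul_le _ _
        · exact norm_mul₃_le
    _ = (1 + ‖R‖) * ‖Q‖ * ‖R - 1‖ := by ring

theorem IsDetectorCorrection.exists_sqrt {M : ℕ} {Pb Ph P : Fin M → Matrix (Fin d) (Fin d) ℂ}
    (h : IsDetectorCorrection Pb Ph) (hP : IsPOVM P) (hsmall : ∑ j, ‖Pb j - P j‖ < 1) :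
    ∃ R : Matrix (Fin d) (Fin d) ℂ, ‖R - 1‖ ≤ ∑ j, ‖Pb j - P j‖ ∧
      ∀ j, ‖R * Ph j * R - P j‖ ≤ ‖Pb j - P j‖ := by
  obtain ⟨-, F, hF, hcor⟩ := h
  have hFP : ∀ j, ‖F j - P j‖ ≤ ‖Pb j - P j‖ := fun j => (hF j).norm_sub_le (hP.1 j)
  have hS : ‖∑ j, F j - 1‖ ≤ ∑ j, ‖Pb j - P j‖ := by
    rw [← hP.2, ← Finset.sum_sub_distrib]
    exact (norm_sum_le _ _).trans (Finset.sum_le_sum fun j _ => hFP j)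
  have hSunit : IsUnit (∑ j, F j).det :=
    (Matrix.isUnit_iff_isUnit_det _).1 (isUnit_of_norm_sub_one_lt (hS.trans_lt hsmall))
  obtain ⟨R, hR, hRR, hPh⟩ := hcor hSunit
  have hRunit : IsUnit R.det := by
    rw [← hRR, Matrix.det_mul] at hSunit
    exact isUnit_of_mul_isUnit_left hSunit
  refine ⟨R, (norm_sub_one_le_norm_mul_self_sub_one hR).trans (hRR ▸ hS), fun j => ?_⟩
  rw [hPh j, ← Matrix.mul_assoc, Matrix.nonsing_inv_mul_cancel_right _ _ hRunit,
    Matrix.mul_nonsing_inv_cancel_left _ _ hRunit]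
  exact hFP j

theorem IsDetectorCorrection.norm_sub_le {M : ℕ} {Pb Ph P : Fin M → Matrix (Fin d) (Fin d) ℂ}
    (h : IsDetectorCorrection Pb Ph) (hP : IsPOVM P) (hsmall : ∑ j, ‖Pb j - P j‖ < 1)
    (j : Fin M) :
    ‖Ph j - P j‖ ≤ ((2 + ‖(1 : Matrix (Fin d) (Fin d) ℂ)‖) * d + 1) * ∑ i, ‖Pb i - P i‖ := by
  obtain ⟨R, hR, hRPh⟩ := h.exists_sqrt hP hsmall
  have hRnorm : ‖R‖ ≤ 1 + ‖(1 : Matrix (Fin d) (Fin d) ℂ)‖ := by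
    have := norm_add_le (R - 1) 1
    rw [sub_add_cancel] at this
    linarith
  have hj : ‖Pb j - P j‖ ≤ ∑ i, ‖Pb i - P i‖ :=
    Finset.single_le_sum (f := fun i => ‖Pb i - P i‖) (fun _ _ => norm_nonneg _)
      (Finset.mem_univ j)
  calc ‖Ph j - P j‖ ≤ ‖Ph j - R * Ph j * R‖ + ‖R * Ph j * R - P j‖ :=
        norm_sub_le_norm_sub_add_norm_sub ..
    _ ≤ (1 + ‖R‖) * ‖Ph j‖ * ‖R - 1‖ + ∑ i, ‖Pb i - P i‖ :=
        add_le_add (norm_sub_mul_mul_le _ _) ((hRPh j).trans hj)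
    _ ≤ (1 + (1 + ‖(1 : Matrix (Fin d) (Fin d) ℂ)‖)) * d * ∑ i, ‖Pb i - P i‖ +
          ∑ i, ‖Pb i - P i‖ := by
        gcongr
        exact h.1.norm_le j
    _ = ((2 + ‖(1 : Matrix (Fin d) (Fin d) ℂ)‖) * d + 1) * ∑ i, ‖Pb i - P i‖ := by ring

end Corrections

/-! ### First-order propagation of errors -/

section Propagation

open Filter Asymptotics Topology

variable {ι : Type*} {l : Filter ι} {e : ι → ℝ} {𝕜 : Type*} [RCLike 𝕜]

theorem isBigO_mul_sub (he : Tendsto e l (𝓝 0)) {f g : ι → 𝕜} {a b : 𝕜}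
    (hf : (fun i => f i - a) =O[l] e) (hg : (fun i => g i - b) =O[l] e) :
    (fun i => f i * g i - a * b) =O[l] e := by
  have hg_lim : Tendsto g l (𝓝 b) := tendsto_sub_nhds_zero_iff.1 (hg.trans_tendsto he)
  have h : (fun i => (f i - a) * g i) =O[l] e := by simpa using hf.mul (hg_lim.isBigO_one ℝ)
  refine (h.add (hg.const_mul_left a)).congr_left fun i => ?_
  ring

theorem isBigO_div_sub (he : Tendsto e l (𝓝 0)) {f g : ι → 𝕜} {a b : 𝕜}
    (hf : (fun i => f i - a) =O[l] e) (hg : (fun i => g i - b) =O[l] e) (hb : b ≠ 0) :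
    (fun i => f i / g i - a / b) =O[l] e := by
  have hg_lim : Tendsto g l (𝓝 b) := tendsto_sub_nhds_zero_iff.1 (hg.trans_tendsto he)
  have hinv : (fun i => (g i * b)⁻¹) =O[l] (fun _ => (1 : ℝ)) :=
    ((hg_lim.mul_const b).inv₀ (mul_ne_zero hb hb)).isBigO_one ℝ
  have hnum : (fun i => (f i - a) * b - a * (g i - b)) =O[l] e := by
    refine IsBigO.sub ?_ (hg.const_mul_left a)
    simpa only [mul_comm] using hf.const_mul_left b
  refine (hnum.mul hinv).congr' ?_ (by simp)
  filter_upwards [hg_lim.eventually_ne hb] with i hi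
  field_simp
  ring

theorem isBigO_linearMap_sub {E F : Type*} [NormedAddCommGroup E] [NormedSpace 𝕜 E]
    [FiniteDimensional 𝕜 E] [NormedAddCommGroup F] [NormedSpace 𝕜 F] (T : E →ₗ[𝕜] F)
    {f : ι → E} {a : E} (hf : (fun i => f i - a) =O[l] e) :
    (fun i => T (f i) - T a) =O[l] e := by
  simpa only [LinearMap.coe_toContinuousLinearMap', map_sub] using
    (T.toContinuousLinearMap.isBigO_comp (fun i => f i - a) l).trans hf

theorem tendsto_sqrt_comap_nhds_zero (err : ι → ℝ) :
    Tendsto (fun i => √(err i)) (comap err (𝓝 0)) (𝓝 0) := by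
  have h := (Real.continuous_sqrt.tendsto 0).comp (tendsto_comap (f := err))
  rwa [Real.sqrt_zero] at h

theorem exists_sq_norm_le_mul_of_isBigO_sqrt {E : Type*} [SeminormedAddCommGroup E]
    {f : ι → E} {err : ι → ℝ} (herr : ∀ i, 0 ≤ err i) {C : ℝ} (hf : ∀ i, ‖f i‖ ≤ C)
    (h : f =O[comap err (𝓝 0)] fun i => √(err i)) : ∃ K, 0 ≤ K ∧ ∀ i, ‖f i‖ ^ 2 ≤ K * err i := by
  obtain ⟨c, hc⟩ := h.bound
  rw [eventually_comap, Metric.eventually_nhds_iff] at hc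
  obtain ⟨δ, hδ, hc⟩ := hc
  refine ⟨max (c ^ 2) (C ^ 2 / δ), by positivity, fun i => ?_⟩
  rcases lt_or_ge (err i) δ with hi | hi
  · have h_small : ‖f i‖ ≤ c * √(err i) := by
      simpa [abs_of_nonneg] using hc (y := err i) (by simpa [abs_of_nonneg (herr i)]) i rfl
    calc ‖f i‖ ^ 2 ≤ (c * √(err i)) ^ 2 := by gcongr
      _ = c ^ 2 * err i := by rw [mul_pow, Real.sq_sqrt (herr i)]
      _ ≤ _ := by gcongr; exacts [herr i, le_max_left _ _]
  · calc ‖f i‖ ^ 2 ≤ C ^ 2 := by gcongr; exact hf i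
      _ = C ^ 2 / δ * δ := by field_simp
      _ ≤ _ := by gcongr; exact le_max_right _ _

variable {m n : Type*} [Fintype m] [Fintype n]

theorem isUnit_det_conjTranspose_mul_self [DecidableEq n] {B : Matrix m n 𝕜}
    (hB : B.rank = Fintype.card n) : IsUnit (Bᴴ * B).det := by
  classical
  have h : Module.finrank 𝕜 (LinearMap.range (Bᴴ * B).mulVecLin) =
      Module.finrank 𝕜 (n → 𝕜) := by
    rw [Module.finrank_pi]
    exact (Matrix.rank_conjTranspose_mul_self B).trans hB
  rw [← Matrix.isUnit_iff_isUnit_det, ← Matrix.mulVec_surjective_iff_isUnit]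
  exact LinearMap.range_eq_top.1 (Submodule.eq_top_of_finrank_eq h)

theorem leastSquares_mulVec [DecidableEq n] {B : Matrix m n 𝕜} (hB : B.rank = Fintype.card n)
    (z : n → 𝕜) : leastSquares B (B *ᵥ z) = z := by
  rw [leastSquares, Matrix.mulVec_mulVec, Matrix.mulVec_mulVec, Matrix.mul_assoc,
    Matrix.nonsing_inv_mul _ (isUnit_det_conjTranspose_mul_self hB), Matrix.one_mulVec]

theorem isBigO_vecMulVec_sub_of_isSVDFactor [DecidableEq n] {B : Matrix m (n × n) 𝕜}
    (hB : B.rank = Fintype.card (n × n)) {Y : ι → m → 𝕜} {x c : ι → n → 𝕜}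
    (h : ∀ i, IsSVDFactor (leastSquares B (Y i)) (x i) (c i)) {a b : n → 𝕜}
    (hY : (fun i => Y i - B *ᵥ fun p => a p.1 * b p.2) =O[l] e) :
    (fun i => Matrix.vecMulVec (x i) (c i) - Matrix.vecMulVec a b) =O[l] e := by
  set T := (LinearEquiv.curry 𝕜 𝕜 n n ≪≫ₗ Matrix.ofLinearEquiv 𝕜).toLinearMap ∘ₗ
    ((Bᴴ * B)⁻¹ * Bᴴ).mulVecLin
  have hT : ∀ y, T y = Matrix.of fun k k' => leastSquares B y (k, k') := fun y => by
    ext k k'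
    simp [T, leastSquares]
  have hT_exact : T (B *ᵥ fun p => a p.1 * b p.2) = Matrix.vecMulVec a b := by
    rw [hT, leastSquares_mulVec hB]
    rfl
  have hlin := isBigO_linearMap_sub T hY
  refine IsBigO.trans (IsBigO.of_bound 2 (Eventually.of_forall fun i => ?_)) hlin
  rw [hT_exact, hT]
  exact (h i).norm_vecMulVec_sub_le a b

section Rescaling

variable {x c : ι → n → 𝕜} {x₀ c₀ : n → 𝕜}

theorem isBigO_dotProduct_smul_sub (w : n → 𝕜)
    (h : (fun i => Matrix.vecMulVec (x i) (c i) - Matrix.vecMulVec x₀ c₀) =O[l] e) :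
    (fun i => (w ⬝ᵥ x i) • c i - (w ⬝ᵥ x₀) • c₀) =O[l] e := by
  have := isBigO_linearMap_sub (𝕜 := 𝕜)
    ((Matrix.vecMulBilin 𝕜 𝕜 w : Matrix n n 𝕜 →ₗ[𝕜] n → 𝕜)) h
  simpa [Matrix.vecMul_vecMulVec] using this

theorem eventually_dotProduct_ne_zero (he : Tendsto e l (𝓝 0)) {w : n → 𝕜}
    (h : (fun i => Matrix.vecMulVec (x i) (c i) - Matrix.vecMulVec x₀ c₀) =O[l] e)
    (hw : w ⬝ᵥ x₀ ≠ 0) (hc₀ : c₀ ≠ 0) : ∀ᶠ i in l, w ⬝ᵥ x i ≠ 0 := by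
  have hlim : Tendsto (fun i => (w ⬝ᵥ x i) • c i) l (𝓝 ((w ⬝ᵥ x₀) • c₀)) :=
    tendsto_sub_nhds_zero_iff.1 ((isBigO_dotProduct_smul_sub w h).trans_tendsto he)
  filter_upwards [hlim.eventually_ne (smul_ne_zero hw hc₀)] with i hi
  exact (smul_ne_zero_iff.1 hi).1

variable {μ : ι → 𝕜}

theorem isBigO_div_smul_right_sub (he : Tendsto e l (𝓝 0)) {w : n → 𝕜}
    (h : (fun i => Matrix.vecMulVec (x i) (c i) - Matrix.vecMulVec x₀ c₀) =O[l] e)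
    (hw : w ⬝ᵥ x₀ ≠ 0) (hμ : (fun i => μ i - w ⬝ᵥ x₀) =O[l] e) :
    (fun i => (w ⬝ᵥ x i / μ i) • c i - c₀) =O[l] e := by
  refine isBigO_pi.2 fun k => ?_
  have hk := isBigO_pi.1 (isBigO_dotProduct_smul_sub w h) k
  refine (isBigO_div_sub he hk hμ hw).congr_left fun i => ?_
  simp [hw, div_mul_eq_mul_div]

theorem isBigO_div_smul_left_sub (he : Tendsto e l (𝓝 0)) {w : n → 𝕜}
    (h : (fun i => Matrix.vecMulVec (x i) (c i) - Matrix.vecMulVec x₀ c₀) =O[l] e)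
    (hw : w ⬝ᵥ x₀ ≠ 0) (hμ : (fun i => μ i - w ⬝ᵥ x₀) =O[l] e) (hc₀ : c₀ ≠ 0) :
    (fun i => (μ i / w ⬝ᵥ x i) • x i - x₀) =O[l] e := by
  obtain ⟨k, hk⟩ : ∃ k, c₀ k ≠ 0 := Function.ne_iff.1 hc₀
  have hne : (w ⬝ᵥ x₀) * c₀ k ≠ 0 := mul_ne_zero hw hk
  have hden := isBigO_pi.1 (isBigO_dotProduct_smul_sub w h) k
  have hden_lim : Tendsto (fun i => (w ⬝ᵥ x i) * c i k) l (𝓝 ((w ⬝ᵥ x₀) * c₀ k)) :=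
    tendsto_sub_nhds_zero_iff.1 (hden.trans_tendsto he)
  refine isBigO_pi.2 fun k' => ?_
  have hnum : (fun i => x i k' * c i k - x₀ k' * c₀ k) =O[l] e :=
    isBigO_linearMap_sub (Matrix.entryLinearMap 𝕜 𝕜 k' k) h
  -- The unknown scale of `x i` cancels in the quotient of `x i k' * c i k` by `(w ⬝ᵥ x i) * c i k`.
  refine (isBigO_mul_sub he hμ (isBigO_div_sub he hnum hden hne)).congr' ?_ EventuallyEq.rfl
  filter_upwards [hden_lim.eventually_ne hne] with i hi
  obtain ⟨hwx, hck⟩ := mul_ne_zero_iff.1 hi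
  simp only [Pi.smul_apply, Pi.sub_apply, smul_eq_mul]
  field_simp

end Rescaling

theorem norm_hermitianPart_sub_le {X X₀ : Matrix n n ℂ} (hX₀ : X₀.IsHermitian) :
    ‖(1 / 2 : ℂ) • (X + Xᴴ) - X₀‖ ≤ ‖X - X₀‖ := by
  have h : (1 / 2 : ℂ) • (X + Xᴴ) - X₀ = (1 / 2 : ℂ) • ((X - X₀) + (X - X₀)ᴴ) := by
    rw [Matrix.conjTranspose_sub, hX₀.eq]
    module
  calc ‖(1 / 2 : ℂ) • (X + Xᴴ) - X₀‖ = 1 / 2 * ‖(X - X₀) + (X - X₀)ᴴ‖ := by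
        rw [h, norm_smul]
        norm_num
    _ ≤ 1 / 2 * (‖X - X₀‖ + ‖(X - X₀)ᴴ‖) := by gcongr; exact norm_add_le _ _
    _ = ‖X - X₀‖ := by rw [Matrix.frobenius_norm_conjTranspose]; ring

namespace StateChoice

variable {M : ℕ}

instance : Finite (StateChoice M) :=
  Finite.of_surjective (fun o : Option (Fin M) => o.elim .average .single) fun
    | .single j => ⟨some j, rfl⟩
    | .average => ⟨none, rfl⟩

theorem isBigO_combine_sub (hM : M ≠ 0) (ch : StateChoice M) {E : Type*} [NormedAddCommGroup E]
    [NormedSpace ℝ E] {v : ι → Fin M → E} {v₀ : E}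
    (h : ∀ j, ch.Uses j → (fun i => v i j - v₀) =O[l] e) :
    (fun i => ch.combine (v i) - v₀) =O[l] e := by
  cases ch with
  | single j => exact h j rfl
  | average =>
    have hsum : (fun i => ∑ j, (v i j - v₀)) =O[l] e := IsBigO.fun_sum fun j _ => h j trivial
    refine (hsum.const_smul_left (1 / M : ℝ)).congr_left fun i => ?_
    have hM' : (M : ℝ) ≠ 0 := Nat.cast_ne_zero.2 hM
    simp only [combine, Finset.sum_sub_distrib, smul_sub, Finset.sum_const, Finset.card_univ,
      Fintype.card_fin, ← Nat.cast_smul_eq_nsmul ℝ M v₀, smul_smul, one_div_mul_cancel hM',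
      one_smul, Pi.smul_apply]

theorem trace_combine (hM : M ≠ 0) (ch : StateChoice M) {v : Fin M → Matrix n n ℂ}
    (h : ∀ j, ch.Uses j → (v j).trace = 1) : (ch.combine v).trace = 1 := by
  cases ch with
  | single j => exact h j rfl
  | average =>
    have hM' : (M : ℂ) ≠ 0 := Nat.cast_ne_zero.2 hM
    simp [combine, Matrix.trace_smul, Matrix.trace_sum, fun j => h j trivial, hM']

end StateChoice

theorem isBigO_stateCorrection {d : ℕ} {ρb ρh : ι → Matrix (Fin d) (Fin d) ℂ}
    {ρ₀ : Matrix (Fin d) (Fin d) ℂ} (hρ₀ : IsDensity ρ₀)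
    (h : ∀ i, IsStateCorrection (ρb i) (ρh i)) (htr : ∀ᶠ i in l, (ρb i).trace = 1)
    (hb : (fun i => ρb i - ρ₀) =O[l] e) : (fun i => ρh i - ρ₀) =O[l] e := by
  refine IsBigO.trans (IsBigO.of_norm_eventuallyLE ?_) hb.norm_left
  filter_upwards [htr] with i hi using (h i).norm_sub_le hi hρ₀

theorem isBigO_detectorCorrection {d M : ℕ} (he : Tendsto e l (𝓝 0))
    {Pb Ph : ι → Fin M → Matrix (Fin d) (Fin d) ℂ} {P : Fin M → Matrix (Fin d) (Fin d) ℂ}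
    (hP : IsPOVM P) (h : ∀ i, IsDetectorCorrection (Pb i) (Ph i))
    (hb : ∀ j, (fun i => Pb i j - P j) =O[l] e) : (fun i => Ph i - P) =O[l] e := by
  have hsum : (fun i => ∑ j, ‖Pb i j - P j‖) =O[l] e := IsBigO.fun_sum fun j _ => (hb j).norm_left
  refine isBigO_pi.2 fun j => IsBigO.trans
    (IsBigO.of_bound ((2 + ‖(1 : Matrix (Fin d) (Fin d) ℂ)‖) * d + 1) ?_) hsum
  filter_upwards [(hsum.trans_tendsto he).eventually_lt_const one_pos] with i hi
  rw [Real.norm_of_nonneg (by positivity)]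
  exact (h i).norm_sub_le hP hi j

end Propagation

/-! ### The exact data -/

section ExactData

variable {d L : ℕ}

theorem trace_mul_eq_ofReal {X Y : Matrix (Fin d) (Fin d) ℂ} (hX : X.IsHermitian)
    (hY : Y.IsHermitian) : (X * Y).trace = ((X * Y).trace.re : ℂ) := by
  refine (Complex.conj_eq_iff_re.1 ?_).symm
  rw [← Complex.star_def, ← Matrix.trace_conjTranspose, Matrix.conjTranspose_mul, hX.eq, hY.eq,
    Matrix.trace_mul_comm]

/-- A process as a linear map on operators. -/
noncomputable def krausMap (A : Fin (d ^ 2) → Matrix (Fin d) (Fin d) ℂ) :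
    Matrix (Fin d) (Fin d) ℂ →ₗ[ℂ] Matrix (Fin d) (Fin d) ℂ where
  toFun := applyKraus A
  map_add' X Y := by simp [applyKraus, Matrix.mul_add, Matrix.add_mul, Finset.sum_add_distrib]
  map_smul' c X := by simp [applyKraus, Finset.smul_sum]

@[simp]
theorem krausMap_apply (A : Fin (d ^ 2) → Matrix (Fin d) (Fin d) ℂ)
    (X : Matrix (Fin d) (Fin d) ℂ) : krausMap A X = applyKraus A X := rfl

theorem naturalMatrix_mulVec_vec (A : Fin (d ^ 2) → Matrix (Fin d) (Fin d) ℂ)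
    (X : Matrix (Fin d) (Fin d) ℂ) :
    naturalMatrix A *ᵥ Matrix.vec X = Matrix.vec (applyKraus A X) := by
  rw [naturalMatrix, applyKraus, Matrix.vec_sum, Matrix.sum_mulVec]
  refine Finset.sum_congr rfl fun i _ => ?_
  rw [Matrix.kronecker_mulVec_vec]
  rfl

theorem vec_dotProduct_mul {R n : Type*} [CommSemiring R] [Fintype n] (T : Matrix n n R)
    (x c : n → R) : Matrix.vec T ⬝ᵥ (fun p => x p.1 * c p.2) = c ⬝ᵥ T *ᵥ x := by
  simp only [dotProduct, Matrix.mulVec, Matrix.vec, Fintype.sum_prod_type, Finset.mul_sum]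
  rw [Finset.sum_comm]
  refine Finset.sum_congr rfl fun k _ => Finset.sum_congr rfl fun l _ => ?_
  ring

theorem designNatural_mulVec (A : Fin L → Fin (d ^ 2) → Matrix (Fin d) (Fin d) ℂ)
    (ρ P : Matrix (Fin d) (Fin d) ℂ) :
    (designNatural A *ᵥ fun p => Matrix.vec ρ p.1 * Matrix.vec Pᵀ p.2) =
      fun a => (P * applyKraus (A a) ρ).trace := by
  ext a
  calc (designNatural A *ᵥ fun p => Matrix.vec ρ p.1 * Matrix.vec Pᵀ p.2) a
      = Matrix.vec Pᵀ ⬝ᵥ naturalMatrix (A a) *ᵥ Matrix.vec ρ := vec_dotProduct_mul _ _ _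
    _ = (P * applyKraus (A a) ρ).trace := by
        rw [naturalMatrix_mulVec_vec, Matrix.vec_dotProduct_vec, Matrix.transpose_transpose]

variable {Ω : Fin (d ^ 2 - 1) → Matrix (Fin d) (Fin d) ℂ}

theorem basisChange_mulVec_vec (Ω : Fin (d ^ 2 - 1) → Matrix (Fin d) (Fin d) ℂ)
    (X : Matrix (Fin d) (Fin d) ℂ) (k : Option (Fin (d ^ 2 - 1))) :
    (basisChange Ω *ᵥ Matrix.vec X) k = ((fullBasis Ω k)ᴴ * X).trace := by
  rw [← Matrix.star_vec_dotProduct_vec]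
  rfl

/-- The operator with the coefficient `y.1` at `1 / √d` and the coefficients `y.2` at the traceless
elements of the basis, as a linear map. -/
noncomputable def synthesis (Ω : Fin (d ^ 2 - 1) → Matrix (Fin d) (Fin d) ℂ) :
    ℝ × (Fin (d ^ 2 - 1) → ℝ) →ₗ[ℝ] Matrix (Fin d) (Fin d) ℂ where
  toFun y := (y.1 : ℂ) • fullBasis Ω none + ∑ k, (y.2 k : ℂ) • Ω k
  map_add' y z := by
    simp only [Prod.fst_add, Prod.snd_add, Pi.add_apply, Complex.ofReal_add, add_smul,
      Finset.sum_add_distrib]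
    abel
  map_smul' c y := by
    simp [mul_smul, Finset.smul_sum]

theorem synthesis_apply (c : ℝ) (x : Fin (d ^ 2 - 1) → ℝ) :
    synthesis Ω (c, x) = (c : ℂ) • fullBasis Ω none + ∑ k, (x k : ℂ) • Ω k := rfl

namespace IsTracelessBasis

theorem trace_synthesis (hΩ : IsTracelessBasis Ω) (c : ℝ) (x : Fin (d ^ 2 - 1) → ℝ) :
    (synthesis Ω (c, x)).trace = ((c * √d : ℝ) : ℂ) := by
  have hsqrt : ((1 / √d : ℝ) : ℂ) * d = ((√d : ℝ) : ℂ) := by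
    rw [← Complex.ofReal_natCast, ← Complex.ofReal_mul, one_div_mul_eq_div, Real.div_sqrt]
  simp only [synthesis_apply, fullBasis, Matrix.trace_add, Matrix.trace_sum, Matrix.trace_smul,
    hΩ.trace_zero, Matrix.trace_one, Fintype.card_fin, smul_eq_mul, mul_zero,
    Finset.sum_const_zero, add_zero, hsqrt, Complex.ofReal_mul]

theorem basisChange_mul_conjTranspose (hΩ : IsTracelessBasis Ω) (hd : d ≠ 0) :
    basisChange Ω * (basisChange Ω)ᴴ = 1 := by
  have hcol : ∀ k l, (basisChange Ω * (basisChange Ω)ᴴ) k l =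
      ((fullBasis Ω k)ᴴ * fullBasis Ω l).trace := fun k l => by
    rw [← basisChange_mulVec_vec]
    simp [Matrix.mul_apply, basisChange, Matrix.mulVec, dotProduct]
  have hnorm : ((1 / √d : ℝ) : ℂ) * ((1 / √d : ℝ) : ℂ) * d = 1 := by
    have h : (1 / √d) * (1 / √d) * d = 1 := by
      rw [div_mul_div_comm, Real.mul_self_sqrt d.cast_nonneg]
      field_simp
    exact_mod_cast h
  ext k l
  rw [hcol]
  rcases k with _ | k <;> rcases l with _ | l
  · simpa [fullBasis, mul_assoc] using hnorm
  · simp [fullBasis, hΩ.trace_zero l]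
  · simp [fullBasis, Matrix.trace_conjTranspose, hΩ.trace_zero k]
  · simpa [fullBasis, Matrix.one_apply] using hΩ.orthonormal k l

theorem conjTranspose_mul_basisChange (hΩ : IsTracelessBasis Ω) (hd : d ≠ 0) :
    (basisChange Ω)ᴴ * basisChange Ω = 1 := by
  have hcard : Fintype.card (Option (Fin (d ^ 2 - 1))) = Fintype.card (Fin d × Fin d) := by
    have : 0 < d ^ 2 := by positivity
    simp only [Fintype.card_option, Fintype.card_fin, Fintype.card_prod]
    rw [Nat.sub_add_cancel this, sq]
  exact (Matrix.mul_eq_one_comm_of_card_eq _ _ _ hcard).1 (hΩ.basisChange_mul_conjTranspose hd)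

theorem synthesis_coeff (hΩ : IsTracelessBasis Ω) (hd : d ≠ 0) {X : Matrix (Fin d) (Fin d) ℂ}
    (hX : X.IsHermitian) : synthesis Ω (X.trace.re / √d, coeff Ω X) = X := by
  have hnone : (basisChange Ω *ᵥ Matrix.vec X) none = ((X.trace.re / √d : ℝ) : ℂ) := by
    have htr : X.trace = (X.trace.re : ℂ) := by
      simpa using trace_mul_eq_ofReal hX Matrix.isHermitian_one
    rw [basisChange_mulVec_vec, fullBasis, Matrix.conjTranspose_smul, Matrix.conjTranspose_one,
      Matrix.smul_mul, Matrix.one_mul, Matrix.trace_smul, htr]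
    simp [div_eq_mul_inv, mul_comm]
  have hsome : ∀ k, (basisChange Ω *ᵥ Matrix.vec X) (some k) = (coeff Ω X k : ℂ) := fun k => by
    rw [basisChange_mulVec_vec, fullBasis, (hΩ.herm k).eq]
    exact trace_mul_eq_ofReal (hΩ.herm k) hX
  have hvec : Matrix.vec X = (basisChange Ω)ᴴ *ᵥ (basisChange Ω *ᵥ Matrix.vec X) := by
    rw [Matrix.mulVec_mulVec, hΩ.conjTranspose_mul_basisChange hd, Matrix.one_mulVec]
  apply Matrix.vec_inj.1
  ext p
  rw [hvec, Matrix.mulVec, dotProduct, Fintype.sum_option, hnone]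
  simp only [hsome]
  simp only [synthesis_apply, Matrix.vec_add, Matrix.vec_smul, Matrix.vec_sum, Pi.add_apply,
    Pi.smul_apply, Finset.sum_apply, smul_eq_mul, Matrix.conjTranspose_apply, basisChange,
    Matrix.of_apply, star_star, fullBasis, mul_comm]

theorem re_trace_mul_eq (hΩ : IsTracelessBasis Ω) (hd : d ≠ 0) {X : Matrix (Fin d) (Fin d) ℂ}
    (hX : X.IsHermitian) (Y : Matrix (Fin d) (Fin d) ℂ) :
    (X * Y).trace.re = X.trace.re / √d * (Y.trace.re / √d) + coeff Ω X ⬝ᵥ coeff Ω Y := by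
  conv_lhs => rw [← hΩ.synthesis_coeff hd hX]
  simp only [synthesis_apply, fullBasis, coeff, dotProduct, Matrix.add_mul, Matrix.sum_mul,
    Matrix.smul_mul, Matrix.one_mul, Matrix.trace_add, Matrix.trace_sum, Matrix.trace_smul,
    smul_eq_mul, Complex.add_re, Complex.re_sum, Complex.re_ofReal_mul]
  ring

theorem tracelessBlock_apply (hΩ : IsTracelessBasis Ω)
    (A : Fin (d ^ 2) → Matrix (Fin d) (Fin d) ℂ) (k l : Fin (d ^ 2 - 1)) :
    tracelessBlock Ω A k l = coeff Ω (applyKraus A (Ω l)) k := by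
  have h : (basisChange Ω * naturalMatrix A * (basisChange Ω)ᴴ) (some k) (some l) =
      (basisChange Ω *ᵥ (naturalMatrix A *ᵥ Matrix.vec (Ω l))) (some k) := by
    rw [Matrix.mulVec_mulVec, Matrix.mul_apply]
    simp [Matrix.mulVec, dotProduct, basisChange, fullBasis]
  rw [tracelessBlock, Matrix.of_apply, h, naturalMatrix_mulVec_vec, basisChange_mulVec_vec,
    fullBasis, (hΩ.herm k).eq, coeff]

theorem tracelessBlock_mulVec_coeff (hΩ : IsTracelessBasis Ω) (hd : d ≠ 0)
    {A : Fin (d ^ 2) → Matrix (Fin d) (Fin d) ℂ} (hA : IsGeneralizedUnital A)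
    {X : Matrix (Fin d) (Fin d) ℂ} (hX : X.IsHermitian) :
    tracelessBlock Ω A *ᵥ coeff Ω X = coeff Ω (applyKraus A X) := by
  obtain ⟨α, -, -, hα⟩ := hA
  ext k
  conv_rhs => rw [← hΩ.synthesis_coeff hd hX, synthesis_apply, ← krausMap_apply]
  simp only [map_add, map_sum, map_smul, krausMap_apply, fullBasis, hα, coeff, Matrix.mul_add,
    Matrix.mul_sum, Matrix.mul_smul, Matrix.mul_one, Matrix.trace_add, Matrix.trace_sum,
    Matrix.trace_smul, hΩ.trace_zero, smul_eq_mul, mul_zero, zero_add, Complex.re_sum,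
    Complex.re_ofReal_mul, Matrix.mulVec, dotProduct, hΩ.tracelessBlock_apply]
  simp only [mul_comm]

theorem designB_mulVec (hΩ : IsTracelessBasis Ω) (hd : d ≠ 0)
    {A : Fin L → Fin (d ^ 2) → Matrix (Fin d) (Fin d) ℂ} (hA : ∀ a, IsGeneralizedUnital (A a))
    {ρ P : Matrix (Fin d) (Fin d) ℂ} (hρ : ρ.IsHermitian) (hP : P.IsHermitian) :
    (designB Ω A *ᵥ fun p => coeff Ω ρ p.1 * coeff Ω P p.2) = fun a =>
      (P * applyKraus (A a) ρ).trace.re -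
        (applyKraus (A a) ρ).trace.re / √d * (P.trace.re / √d) := by
  ext a
  calc (designB Ω A *ᵥ fun p => coeff Ω ρ p.1 * coeff Ω P p.2) a
      = coeff Ω P ⬝ᵥ tracelessBlock Ω (A a) *ᵥ coeff Ω ρ :=
        vec_dotProduct_mul (tracelessBlock Ω (A a)) (coeff Ω ρ) (coeff Ω P)
    _ = _ := by
        rw [hΩ.tracelessBlock_mulVec_coeff hd (hA a) hρ, hΩ.re_trace_mul_eq hd hP]
        ring

end IsTracelessBasis

end ExactData

/-! ### Independent measurements -/

section Sampling

variable {κ α β : Type*} [Fintype κ] [DecidableEq κ] [Fintype α] [Fintype β]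

theorem prod_dotProduct_prod (q f : κ → α → ℝ) :
    (fun r : κ → α => ∏ a, q a (r a)) ⬝ᵥ (fun r => ∏ a, f a (r a)) = ∏ a, q a ⬝ᵥ f a := by
  simp only [dotProduct, ← Finset.prod_mul_distrib]
  rw [Finset.prod_univ_sum, Fintype.piFinset_univ]

theorem prod_mem_stdSimplex {q : κ → α → ℝ} (hq : ∀ a, q a ∈ stdSimplex ℝ α) :
    (fun r : κ → α => ∏ a, q a (r a)) ∈ stdSimplex ℝ (κ → α) :=
  ⟨fun _ => Finset.prod_nonneg fun a _ => (hq a).1 _, by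
    rw [← Fintype.piFinset_univ, ← Finset.prod_univ_sum]
    exact Finset.prod_eq_one fun a _ => (hq a).2⟩

theorem dotProduct_one_of_mem_stdSimplex {p : α → ℝ} (hp : p ∈ stdSimplex ℝ α) :
    p ⬝ᵥ (fun _ => 1) = 1 := by
  simpa only [dotProduct, mul_one] using hp.2

theorem prod_dotProduct_eval_mul_eval {q : κ → α → ℝ} (hq : ∀ a, q a ∈ stdSimplex ℝ α) {i j : κ}
    (hij : i ≠ j) (f g : α → ℝ) :
    (fun r : κ → α => ∏ a, q a (r a)) ⬝ᵥ (fun r => f (r i) * g (r j)) =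
      (q i ⬝ᵥ f) * (q j ⬝ᵥ g) := by
  have h := prod_dotProduct_prod q (Function.update (Function.update (fun _ _ => 1) i f) j g)
  rw [Fintype.prod_eq_mul i j hij fun a ha => by
    simpa [ha.1, ha.2] using dotProduct_one_of_mem_stdSimplex (hq a)] at h
  convert h using 2
  · ext r
    rw [Fintype.prod_eq_mul i j hij fun a ha => by simp [ha.1, ha.2]]
    simp [hij]
  all_goals simp [hij]

theorem prod_dotProduct_eval {q : κ → α → ℝ} (hq : ∀ a, q a ∈ stdSimplex ℝ α) (i : κ)
    (f : α → ℝ) :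
    (fun r : κ → α => ∏ a, q a (r a)) ⬝ᵥ (fun r => f (r i)) = q i ⬝ᵥ f := by
  have h := prod_dotProduct_prod q (Function.update (fun _ _ => 1) i f)
  rw [Fintype.prod_eq_single i fun a ha => by
    simpa [ha] using dotProduct_one_of_mem_stdSimplex (hq a)] at h
  convert h using 2
  · ext r
    rw [Fintype.prod_eq_single i fun a ha => by simp [ha]]
    simp
  · simp

/-- The distribution of a pair of independent outcomes with the distributions `p` and `q`. -/
def pairProb (p : α → ℝ) (q : β → ℝ) (z : α × β) : ℝ := p z.1 * q z.2

theorem pairProb_mem_stdSimplex {p : α → ℝ} {q : β → ℝ} (hp : p ∈ stdSimplex ℝ α)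
    (hq : q ∈ stdSimplex ℝ β) : pairProb p q ∈ stdSimplex ℝ (α × β) :=
  ⟨fun z => mul_nonneg (hp.1 z.1) (hq.1 z.2), by
    simp only [pairProb, Fintype.sum_prod_type, ← Finset.mul_sum, hp.2, hq.2, mul_one]⟩

theorem pairProb_dotProduct_fst (p : α → ℝ) {q : β → ℝ} (hq : q ∈ stdSimplex ℝ β) (f : α → ℝ) :
    pairProb p q ⬝ᵥ (fun z => f z.1) = p ⬝ᵥ f := by
  simp only [pairProb, dotProduct, Fintype.sum_prod_type, ← Finset.mul_sum, ← Finset.sum_mul, hq.2,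
    mul_one]

theorem pairProb_dotProduct_snd {p : α → ℝ} (hp : p ∈ stdSimplex ℝ α) (q f : β → ℝ) :
    pairProb p q ⬝ᵥ (fun z => f z.2) = q ⬝ᵥ f := by
  simp only [pairProb, dotProduct, Fintype.sum_prod_type, mul_assoc, ← Finset.mul_sum,
    ← Finset.sum_mul, hp.2, one_mul]

variable {n : ℕ}

theorem seqProb_mem_stdSimplex {p : α → ℝ} (hp : p ∈ stdSimplex ℝ α) :
    seqProb p ∈ stdSimplex ℝ (Fin n → α) :=
  prod_mem_stdSimplex fun _ => hp

theorem seqProb_dotProduct_sq_sum {p f : α → ℝ} (hp : p ∈ stdSimplex ℝ α) (hf : p ⬝ᵥ f = 0) :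
    seqProb p ⬝ᵥ (fun s : Fin n → α => (∑ i, f (s i)) ^ 2) = n * (p ⬝ᵥ fun x => f x ^ 2) := by
  have hpair (i j : Fin n) : seqProb p ⬝ᵥ (fun s : Fin n → α => f (s i) * f (s j)) =
      if i = j then p ⬝ᵥ fun x => f x ^ 2 else 0 := by
    rcases eq_or_ne i j with rfl | hij
    · simp only [← sq, if_true]
      exact prod_dotProduct_eval (q := fun _ => p) (fun _ => hp) i fun x => f x ^ 2
    · rw [if_neg hij, show (0 : ℝ) = (p ⬝ᵥ f) * (p ⬝ᵥ f) by rw [hf, zero_mul]]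
      exact prod_dotProduct_eval_mul_eval (q := fun _ => p) (fun _ => hp) hij f f
  have hsq : (fun s : Fin n → α => (∑ i, f (s i)) ^ 2) =
      ∑ i, ∑ j, fun s => f (s i) * f (s j) := by
    ext s
    simp only [sq, Finset.sum_mul_sum, Finset.sum_apply]
  simp [hsq, dotProduct_sum, hpair]

theorem seqProb_dotProduct_sq_average_sub (hn : 0 < n) {p : α → ℝ} (hp : p ∈ stdSimplex ℝ α)
    (g : α → ℝ) :
    seqProb p ⬝ᵥ (fun s : Fin n → α => ((∑ i, g (s i)) / n - p ⬝ᵥ g) ^ 2) =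
      (p ⬝ᵥ fun x => (g x - p ⬝ᵥ g) ^ 2) / n := by
  have hn' : (n : ℝ) ≠ 0 := by positivity
  have hcentred : p ⬝ᵥ (fun x => g x - p ⬝ᵥ g) = 0 := by
    simp only [dotProduct, mul_sub, Finset.sum_sub_distrib, ← Finset.sum_mul, hp.2, one_mul,
      sub_self]
  have hsq : (fun s : Fin n → α => ((∑ i, g (s i)) / n - p ⬝ᵥ g) ^ 2) =
      ((n : ℝ) ^ 2)⁻¹ • fun s => (∑ i, (g (s i) - p ⬝ᵥ g)) ^ 2 := by
    ext s
    simp only [Finset.sum_sub_distrib, Finset.sum_const, Finset.card_univ, Fintype.card_fin,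
      nsmul_eq_mul, Pi.smul_apply, smul_eq_mul]
    field_simp
  rw [hsq, dotProduct_smul, seqProb_dotProduct_sq_sum hp hcentred, smul_eq_mul]
  field_simp

theorem seqProb_dotProduct_sq_freq_sub_le (hn : 0 < n) {p : α → ℝ} (hp : p ∈ stdSimplex ℝ α)
    (y : α) : seqProb p ⬝ᵥ (fun s : Fin n → α => (freq s y - p y) ^ 2) ≤ 1 / n := by
  classical
  have hmean : p ⬝ᵥ (fun x => if x = y then 1 else 0) = p y := by simp [dotProduct]
  have hfreq (s : Fin n → α) : freq s y = (∑ i, if s i = y then 1 else 0) / n := by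
    rw [freq, Finset.sum_boole]
  have hvar : p ⬝ᵥ (fun x => ((if x = y then 1 else 0) - p y) ^ 2) ≤ 1 := by
    refine (dotProduct_le_dotProduct_of_nonneg_left (fun x => ?_) hp.1).trans_eq
      (dotProduct_one_of_mem_stdSimplex hp)
    have hy := mem_Icc_of_mem_stdSimplex hp y
    dsimp only
    split_ifs <;> nlinarith [hy.1, hy.2]
  have h := seqProb_dotProduct_sq_average_sub hn hp fun x => if x = y then 1 else 0
  simp only [hmean, ← hfreq] at h
  rw [h]
  gcongr

end Sampling

section Born

variable {d M : ℕ} {A : Fin (d ^ 2) → Matrix (Fin d) (Fin d) ℂ}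
  {ρ σ O : Matrix (Fin d) (Fin d) ℂ} {P : Fin M → Matrix (Fin d) (Fin d) ℂ}

theorem IsDensity.dim_ne_zero (h : IsDensity ρ) : d ≠ 0 := by
  rintro rfl
  simpa [Matrix.trace] using h.2

theorem re_trace_mul_nonneg {X Y : Matrix (Fin d) (Fin d) ℂ} (hX : X.PosSemidef)
    (hY : Y.PosSemidef) : 0 ≤ (X * Y).trace.re := by
  rw [eq_spectralMatrix_of_isHermitian hX.1, re_trace_spectralMatrix_mul]
  exact Finset.sum_nonneg fun i _ =>
    mul_nonneg (hX.eigenvalues_nonneg i) (re_diag_conj_nonneg hY _ i)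

theorem posSemidef_applyKraus (A : Fin (d ^ 2) → Matrix (Fin d) (Fin d) ℂ) (hσ : σ.PosSemidef) :
    (applyKraus A σ).PosSemidef :=
  Matrix.posSemidef_sum _ fun i _ => hσ.mul_mul_conjTranspose_same (A i)

theorem trace_applyKraus (A : Fin (d ^ 2) → Matrix (Fin d) (Fin d) ℂ)
    (σ : Matrix (Fin d) (Fin d) ℂ) :
    (applyKraus A σ).trace = ((∑ i, (A i)ᴴ * A i) * σ).trace := by
  rw [applyKraus, Finset.sum_mul, Matrix.trace_sum, Matrix.trace_sum]
  refine Finset.sum_congr rfl fun i _ => ?_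
  rw [Matrix.trace_mul_comm, Matrix.mul_assoc]

theorem re_trace_applyKraus_le_one (hA : IsProcess A) (hρ : IsDensity ρ) :
    (applyKraus A ρ).trace.re ≤ 1 := by
  have h := re_trace_mul_nonneg hA hρ.1
  rw [Matrix.sub_mul, Matrix.one_mul, Matrix.trace_sub, hρ.2, ← trace_applyKraus] at h
  simpa using h

theorem trace_applyKraus_of_isTP (hA : IsTP A) (σ : Matrix (Fin d) (Fin d) ℂ) :
    (applyKraus A σ).trace = σ.trace := by
  rw [trace_applyKraus, hA, Matrix.one_mul]

theorem detectProb_mem_stdSimplex (hP : IsPOVM P) (hσ : σ.PosSemidef) (h1 : σ.trace.re ≤ 1) :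
    detectProb P σ ∈ stdSimplex ℝ (Option (Fin M)) := by
  refine ⟨Option.rec (sub_nonneg.2 h1) fun j => re_trace_mul_nonneg (hP.1 j) hσ, ?_⟩
  simp only [Fintype.sum_option, detectProb]
  rw [← Complex.re_sum, ← Matrix.trace_sum, ← Finset.sum_mul, hP.2, Matrix.one_mul,
    sub_add_cancel]

theorem identityProb_mem_stdSimplex (hσ : σ.PosSemidef) (h1 : σ.trace.re ≤ 1) :
    identityProb σ ∈ stdSimplex ℝ Bool :=
  ⟨Bool.rec (sub_nonneg.2 h1) (Complex.le_def.1 hσ.trace_nonneg).1, by simp [identityProb]⟩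

theorem mixedProb_eq (P : Fin M → Matrix (Fin d) (Fin d) ℂ) (j : Fin M) :
    mixedProb P j = (P j).trace.re / d := by
  rw [mixedProb, Matrix.mul_smul, Matrix.mul_one, Matrix.trace_smul, smul_eq_mul,
    Complex.re_ofReal_mul, one_div_mul_eq_div]

theorem mixedProb_mem_stdSimplex (hd : d ≠ 0) (hP : IsPOVM P) :
    mixedProb P ∈ stdSimplex ℝ (Fin M) := by
  refine ⟨fun j => ?_, ?_⟩
  · rw [mixedProb_eq]
    exact div_nonneg (Complex.le_def.1 (hP.1 j).trace_nonneg).1 d.cast_nonneg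
  · simp only [mixedProb_eq]
    rw [← Finset.sum_div, ← Complex.re_sum, ← Matrix.trace_sum, hP.2]
    simp [hd]

theorem observableProb_mem_stdSimplex (hO : O.IsHermitian) (hρ : IsDensity ρ) :
    observableProb hO ρ ∈ stdSimplex ℝ (Fin d) :=
  ⟨re_diag_conj_nonneg hρ.1 _, (sum_re_diag_conj hO.eigenvectorUnitary.2 ρ).trans <| by
    rw [hρ.2, Complex.one_re]⟩

theorem observableProb_dotProduct_eigenvalues (hO : O.IsHermitian)
    (ρ : Matrix (Fin d) (Fin d) ℂ) :
    observableProb hO ρ ⬝ᵥ hO.eigenvalues = (O * ρ).trace.re := by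
  rw [dotProduct_comm]
  conv_rhs => rw [eq_spectralMatrix_of_isHermitian hO, re_trace_spectralMatrix_mul]
  rfl

end Born

section Records

variable {d L M N₀ : ℕ} {A : Fin L → Fin (d ^ 2) → Matrix (Fin d) (Fin d) ℂ}
  {ρ₀ : Matrix (Fin d) (Fin d) ℂ} {P : Fin M → Matrix (Fin d) (Fin d) ℂ}

/-- The squared distance between the relative frequencies of the detector outcomes in a record and
their probabilities. -/
noncomputable def outputError (A : Fin L → Fin (d ^ 2) → Matrix (Fin d) (Fin d) ℂ)
    (ρ₀ : Matrix (Fin d) (Fin d) ℂ) (P : Fin M → Matrix (Fin d) (Fin d) ℂ)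
    (r : OutputRecord L M N₀) : ℝ :=
  ∑ a, ∑ j, (yHat r a j - (P j * applyKraus (A a) ρ₀).trace.re) ^ 2

theorem outputError_nonneg (r : OutputRecord L M N₀) : 0 ≤ outputError A ρ₀ P r := by
  unfold outputError
  positivity

section

variable (hA : ∀ a, IsProcess (A a)) (hρ₀ : IsDensity ρ₀) (hP : IsPOVM P)
include hA hρ₀ hP

theorem seqProb_detectProb_mem_stdSimplex (a : Fin L) :
    seqProb (n := N₀) (detectProb P (applyKraus (A a) ρ₀)) ∈ stdSimplex ℝ _ :=
  seqProb_mem_stdSimplex <| detectProb_mem_stdSimplex hP (posSemidef_applyKraus (A a) hρ₀.1)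
    (re_trace_applyKraus_le_one (hA a) hρ₀)

theorem outputRecordProb_mem_stdSimplex :
    outputRecordProb (N₀ := N₀) A ρ₀ P ∈ stdSimplex ℝ (OutputRecord L M N₀) :=
  prod_mem_stdSimplex (seqProb_detectProb_mem_stdSimplex hA hρ₀ hP)

theorem outputExpectation_outputError_le (hN : 0 < N₀) :
    outputExpectation (N₀ := N₀) A ρ₀ P (outputError A ρ₀ P) ≤ L * M / N₀ := by
  have hterm (a : Fin L) (j : Fin M) : outputRecordProb A ρ₀ P ⬝ᵥ (fun r : OutputRecord L M N₀ =>
      (yHat r a j - (P j * applyKraus (A a) ρ₀).trace.re) ^ 2) ≤ 1 / N₀ :=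
    (prod_dotProduct_eval (seqProb_detectProb_mem_stdSimplex hA hρ₀ hP) a fun s =>
      (freq s (some j) - (P j * applyKraus (A a) ρ₀).trace.re) ^ 2).trans_le <|
    seqProb_dotProduct_sq_freq_sub_le hN (detectProb_mem_stdSimplex hP
      (posSemidef_applyKraus (A a) hρ₀.1) (re_trace_applyKraus_le_one (hA a) hρ₀)) (some j)
  have hsum : (outputError A ρ₀ P : OutputRecord L M N₀ → ℝ) = ∑ a, ∑ j, fun r =>
      (yHat r a j - (P j * applyKraus (A a) ρ₀).trace.re) ^ 2 := by
    ext r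
    simp only [outputError, Finset.sum_apply]
  calc outputExpectation (N₀ := N₀) A ρ₀ P (outputError A ρ₀ P)
      = ∑ a, ∑ j, outputRecordProb A ρ₀ P ⬝ᵥ (fun r : OutputRecord L M N₀ =>
          (yHat r a j - (P j * applyKraus (A a) ρ₀).trace.re) ^ 2) := by
        simp only [← dotProduct_sum, ← hsum]
        rfl
    _ ≤ ∑ a : Fin L, ∑ j : Fin M, (1 / N₀ : ℝ) := by gcongr; exact hterm _ _
    _ = L * M / N₀ := by simp [div_eq_mul_inv, mul_assoc]

theorem outputExpectation_le_of_le_mul_outputError (hL : 0 < L) (hN : 0 < N₀) {K : ℝ}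
    (hK : 0 ≤ K) {f : OutputRecord L M N₀ → ℝ} (hf : ∀ r, f r ≤ K * outputError A ρ₀ P r) :
    outputExpectation A ρ₀ P f ≤ K * (L * M * L) / ((L * N₀ : ℕ) : ℝ) :=
  calc outputExpectation A ρ₀ P f
      ≤ outputRecordProb A ρ₀ P ⬝ᵥ (K • outputError A ρ₀ P) :=
        dotProduct_le_dotProduct_of_nonneg_left hf (outputRecordProb_mem_stdSimplex hA hρ₀ hP).1
    _ = K * outputExpectation (N₀ := N₀) A ρ₀ P (outputError A ρ₀ P) := dotProduct_smul ..
    _ ≤ K * (L * M / N₀) := by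
        gcongr
        exact outputExpectation_outputError_le hA hρ₀ hP hN
    _ = K * (L * M * L) / ((L * N₀ : ℕ) : ℝ) := by
        push_cast
        field_simp

end

variable {O : Matrix (Fin d) (Fin d) ℂ} (hO : O.IsHermitian)

/-- The squared error of all data that the orthonormal-basis algorithm extracts from a record. -/
noncomputable def fullError (A : Fin L → Fin (d ^ 2) → Matrix (Fin d) (Fin d) ℂ)
    (ρ₀ : Matrix (Fin d) (Fin d) ℂ) (P : Fin M → Matrix (Fin d) (Fin d) ℂ)
    {O : Matrix (Fin d) (Fin d) ℂ} (hO : O.IsHermitian) (r : FullRecord A M N₀) : ℝ :=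
  outputError A ρ₀ P r.1 + ∑ a, (xHatZero r a - (applyKraus (A a) ρ₀).trace.re / √d) ^ 2 +
    ∑ j, (cHatZero r j - (P j).trace.re / √d) ^ 2 + (observableMean hO r - (O * ρ₀).trace.re) ^ 2

theorem fullError_nonneg (r : FullRecord A M N₀) : 0 ≤ fullError A ρ₀ P hO r := by
  have := outputError_nonneg (A := A) (ρ₀ := ρ₀) (P := P) r.1
  unfold fullError
  positivity

open scoped Classical in
/-- The distribution of the outcomes of the operator `1` on the outputs of the processes that are
not trace-preserving. -/
noncomputable def identityRecordProb (A : Fin L → Fin (d ^ 2) → Matrix (Fin d) (Fin d) ℂ)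
    (ρ₀ : Matrix (Fin d) (Fin d) ℂ) (r : {a : Fin L // ¬ IsTP (A a)} → Fin N₀ → Bool) : ℝ :=
  ∏ a, seqProb (identityProb (applyKraus (A a.1) ρ₀)) (r a)

theorem fullRecordProb_eq_pairProb : fullRecordProb (N₀ := N₀) A ρ₀ P hO =
    pairProb (outputRecordProb A ρ₀ P) (pairProb (identityRecordProb A ρ₀)
      (pairProb (seqProb (mixedProb P)) (seqProb (observableProb hO ρ₀)))) := by
  ext r
  simp only [fullRecordProb, identityRecordProb, pairProb, mul_assoc]

open scoped Classical in
theorem fullExpectation_eq_dotProduct (f : FullRecord A M N₀ → ℝ) :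
    fullExpectation A ρ₀ P hO f = pairProb (outputRecordProb A ρ₀ P)
      (pairProb (identityRecordProb A ρ₀)
        (pairProb (seqProb (mixedProb P)) (seqProb (observableProb hO ρ₀)))) ⬝ᵥ f := by
  rw [← fullRecordProb_eq_pairProb]
  rfl

section

variable (hA : ∀ a, IsProcess (A a)) (hρ₀ : IsDensity ρ₀) (hP : IsPOVM P)
include hA hρ₀

theorem seqProb_identityProb_mem_stdSimplex (a : {a : Fin L // ¬ IsTP (A a)}) :
    seqProb (n := N₀) (identityProb (applyKraus (A a.1) ρ₀)) ∈ stdSimplex ℝ _ :=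
  seqProb_mem_stdSimplex <| identityProb_mem_stdSimplex (posSemidef_applyKraus (A a) hρ₀.1)
    (re_trace_applyKraus_le_one (hA a) hρ₀)

open scoped Classical in
theorem identityRecordProb_mem_stdSimplex :
    identityRecordProb (N₀ := N₀) A ρ₀ ∈ stdSimplex ℝ _ :=
  prod_mem_stdSimplex (seqProb_identityProb_mem_stdSimplex hA hρ₀)

include hP

omit hA in
theorem pairProb_mixedProb_observableProb_mem_stdSimplex :
    pairProb (seqProb (n := N₀) (mixedProb P)) (seqProb (n := N₀) (observableProb hO ρ₀)) ∈
      stdSimplex ℝ _ :=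
  pairProb_mem_stdSimplex (seqProb_mem_stdSimplex (mixedProb_mem_stdSimplex hρ₀.dim_ne_zero hP))
    (seqProb_mem_stdSimplex (observableProb_mem_stdSimplex hO hρ₀))

open scoped Classical in
theorem fullRecordProb_mem_stdSimplex :
    fullRecordProb (N₀ := N₀) A ρ₀ P hO ∈ stdSimplex ℝ (FullRecord A M N₀) := by
  rw [fullRecordProb_eq_pairProb]
  exact pairProb_mem_stdSimplex (outputRecordProb_mem_stdSimplex hA hρ₀ hP) <|
    pairProb_mem_stdSimplex (identityRecordProb_mem_stdSimplex hA hρ₀)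
      (pairProb_mixedProb_observableProb_mem_stdSimplex hO hρ₀ hP)

theorem fullExpectation_output (f : OutputRecord L M N₀ → ℝ) :
    fullExpectation A ρ₀ P hO (fun r => f r.1) = outputExpectation A ρ₀ P f := by
  classical
  rw [fullExpectation_eq_dotProduct]
  exact pairProb_dotProduct_fst _ (pairProb_mem_stdSimplex
    (identityRecordProb_mem_stdSimplex hA hρ₀)
    (pairProb_mixedProb_observableProb_mem_stdSimplex hO hρ₀ hP)) f

theorem fullExpectation_identity (a : {a : Fin L // ¬ IsTP (A a)}) (f : (Fin N₀ → Bool) → ℝ) :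
    fullExpectation A ρ₀ P hO (fun r => f (r.2.1 a)) =
      seqProb (identityProb (applyKraus (A a.1) ρ₀)) ⬝ᵥ f := by
  classical
  rw [fullExpectation_eq_dotProduct]
  refine (pairProb_dotProduct_snd (outputRecordProb_mem_stdSimplex hA hρ₀ hP) _
    fun r : ({a : Fin L // ¬ IsTP (A a)} → Fin N₀ → Bool) × (Fin N₀ → Fin M) × (Fin N₀ → Fin d) =>
      f (r.1 a)).trans ?_
  refine (pairProb_dotProduct_fst _ (pairProb_mixedProb_observableProb_mem_stdSimplex hO hρ₀ hP)
    fun r : {a : Fin L // ¬ IsTP (A a)} → Fin N₀ → Bool => f (r a)).trans ?_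
  exact prod_dotProduct_eval (seqProb_identityProb_mem_stdSimplex hA hρ₀) a f

theorem fullExpectation_mixed (f : (Fin N₀ → Fin M) → ℝ) :
    fullExpectation A ρ₀ P hO (fun r => f r.2.2.1) = seqProb (mixedProb P) ⬝ᵥ f := by
  classical
  rw [fullExpectation_eq_dotProduct]
  refine (pairProb_dotProduct_snd (outputRecordProb_mem_stdSimplex hA hρ₀ hP) _
    fun r : _ × _ × (Fin N₀ → Fin d) => f r.2.1).trans ?_
  refine (pairProb_dotProduct_snd (identityRecordProb_mem_stdSimplex hA hρ₀) _
    fun r : _ × (Fin N₀ → Fin d) => f r.1).trans ?_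
  exact pairProb_dotProduct_fst _ (seqProb_mem_stdSimplex (observableProb_mem_stdSimplex hO hρ₀)) f

theorem fullExpectation_observable (f : (Fin N₀ → Fin d) → ℝ) :
    fullExpectation A ρ₀ P hO (fun r => f r.2.2.2) = seqProb (observableProb hO ρ₀) ⬝ᵥ f := by
  classical
  rw [fullExpectation_eq_dotProduct]
  refine (pairProb_dotProduct_snd (outputRecordProb_mem_stdSimplex hA hρ₀ hP) _
    fun r : _ × (Fin N₀ → Fin M) × _ => f r.2.2).trans ?_
  refine (pairProb_dotProduct_snd (identityRecordProb_mem_stdSimplex hA hρ₀) _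
    fun r : (Fin N₀ → Fin M) × _ => f r.2).trans ?_
  exact pairProb_dotProduct_snd
    (seqProb_mem_stdSimplex (mixedProb_mem_stdSimplex hρ₀.dim_ne_zero hP)) _ f

theorem fullExpectation_sq_xHatZero_sub_le (hN : 0 < N₀) (a : Fin L) :
    fullExpectation A ρ₀ P hO (fun r : FullRecord A M N₀ =>
      (xHatZero r a - (applyKraus (A a) ρ₀).trace.re / √d) ^ 2) ≤ 1 / N₀ := by
  by_cases ha : IsTP (A a)
  · have hzero (r : FullRecord A M N₀) :
        xHatZero r a - (applyKraus (A a) ρ₀).trace.re / √d = 0 := by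
      rw [xHatZero, dif_pos ha, trace_applyKraus_of_isTP ha, hρ₀.2, Complex.one_re, sub_self]
    simp only [fullExpectation, hzero, zero_pow two_ne_zero, mul_zero, Finset.sum_const_zero]
    positivity
  · have hd : (1 : ℝ) ≤ d := Nat.one_le_cast.2 (Nat.one_le_iff_ne_zero.2 hρ₀.dim_ne_zero)
    have hprob := identityProb_mem_stdSimplex (posSemidef_applyKraus (A a) hρ₀.1)
      (re_trace_applyKraus_le_one (hA a) hρ₀)
    calc _ = seqProb (identityProb (applyKraus (A a) ρ₀)) ⬝ᵥ fun s : Fin N₀ → Bool =>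
          (freq s true / √d - (applyKraus (A a) ρ₀).trace.re / √d) ^ 2 := by
          simp only [xHatZero, dif_neg ha]
          exact fullExpectation_identity hO hA hρ₀ hP ⟨a, ha⟩ fun s =>
            (freq s true / √d - (applyKraus (A a) ρ₀).trace.re / √d) ^ 2
      _ ≤ seqProb (identityProb (applyKraus (A a) ρ₀)) ⬝ᵥ fun s : Fin N₀ → Bool =>
          (freq s true - (applyKraus (A a) ρ₀).trace.re) ^ 2 := by
          refine dotProduct_le_dotProduct_of_nonneg_left (fun s => ?_)
            (seqProb_mem_stdSimplex hprob).1
          rw [← sub_div, div_pow, Real.sq_sqrt d.cast_nonneg]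
          exact div_le_self (sq_nonneg _) hd
      _ ≤ 1 / N₀ := seqProb_dotProduct_sq_freq_sub_le hN hprob true

theorem fullExpectation_sq_cHatZero_sub_le (hN : 0 < N₀) (j : Fin M) :
    fullExpectation A ρ₀ P hO (fun r : FullRecord A M N₀ =>
      (cHatZero r j - (P j).trace.re / √d) ^ 2) ≤ d / N₀ := by
  have hscale (s : Fin N₀ → Fin M) : (√d * freq s j - (P j).trace.re / √d) ^ 2 =
      d * (freq s j - mixedProb P j) ^ 2 := by
    have hdiv : (P j).trace.re / √d = √d * mixedProb P j := by
      rw [mixedProb_eq, mul_div_left_comm, Real.sqrt_div_self, div_eq_mul_inv]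
    rw [hdiv, ← mul_sub, mul_pow, Real.sq_sqrt d.cast_nonneg]
  calc _ = seqProb (mixedProb P) ⬝ᵥ fun s : Fin N₀ → Fin M =>
        (√d * freq s j - (P j).trace.re / √d) ^ 2 := fullExpectation_mixed hO hA hρ₀ hP _
    _ = d * (seqProb (mixedProb P) ⬝ᵥ fun s : Fin N₀ → Fin M =>
        (freq s j - mixedProb P j) ^ 2) := by
        simp only [hscale]
        exact dotProduct_smul (d : ℝ) _ _
    _ ≤ d * (1 / N₀) := by
        gcongr
        exact seqProb_dotProduct_sq_freq_sub_le hN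
          (mixedProb_mem_stdSimplex hρ₀.dim_ne_zero hP) j
    _ = d / N₀ := mul_one_div _ _

theorem fullExpectation_sq_observableMean_sub (hN : 0 < N₀) :
    fullExpectation A ρ₀ P hO (fun r : FullRecord A M N₀ =>
      (observableMean hO r - (O * ρ₀).trace.re) ^ 2) =
      (observableProb hO ρ₀ ⬝ᵥ fun i => (hO.eigenvalues i - (O * ρ₀).trace.re) ^ 2) / N₀ := by
  rw [← observableProb_dotProduct_eigenvalues hO ρ₀]
  exact (fullExpectation_observable hO hA hρ₀ hP fun s =>
    ((∑ i, hO.eigenvalues (s i)) / N₀ - observableProb hO ρ₀ ⬝ᵥ hO.eigenvalues) ^ 2).trans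
    (seqProb_dotProduct_sq_average_sub hN (observableProb_mem_stdSimplex hO hρ₀) _)

theorem exists_fullExpectation_fullError_le :
    ∃ C, ∀ N₀ : ℕ, 0 < N₀ →
      fullExpectation (N₀ := N₀) A ρ₀ P hO (fullError A ρ₀ P hO) ≤ C / N₀ := by
  refine ⟨L * M + L + M * d + observableProb hO ρ₀ ⬝ᵥ fun i =>
    (hO.eigenvalues i - (O * ρ₀).trace.re) ^ 2, fun N₀ hN => ?_⟩
  have hx : ∑ a, fullExpectation A ρ₀ P hO (fun r : FullRecord A M N₀ =>
      (xHatZero r a - (applyKraus (A a) ρ₀).trace.re / √d) ^ 2) ≤ L / N₀ :=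
    (Finset.sum_le_sum fun a _ => fullExpectation_sq_xHatZero_sub_le hO hA hρ₀ hP hN a).trans_eq
      (by simp [div_eq_mul_inv])
  have hc : ∑ j, fullExpectation A ρ₀ P hO (fun r : FullRecord A M N₀ =>
      (cHatZero r j - (P j).trace.re / √d) ^ 2) ≤ M * d / N₀ :=
    (Finset.sum_le_sum fun j _ => fullExpectation_sq_cHatZero_sub_le hO hA hρ₀ hP hN j).trans_eq
      (by simp [mul_div_assoc])
  have hsum : fullExpectation (N₀ := N₀) A ρ₀ P hO (fullError A ρ₀ P hO) =
      fullExpectation A ρ₀ P hO (fun r : FullRecord A M N₀ => outputError A ρ₀ P r.1) +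
      ∑ a, fullExpectation A ρ₀ P hO (fun r : FullRecord A M N₀ =>
        (xHatZero r a - (applyKraus (A a) ρ₀).trace.re / √d) ^ 2) +
      ∑ j, fullExpectation A ρ₀ P hO (fun r : FullRecord A M N₀ =>
        (cHatZero r j - (P j).trace.re / √d) ^ 2) +
      fullExpectation A ρ₀ P hO (fun r : FullRecord A M N₀ =>
        (observableMean hO r - (O * ρ₀).trace.re) ^ 2) := by
    simp only [fullExpectation, fullError, mul_add, Finset.mul_sum, Finset.sum_add_distrib]
    rw [Finset.sum_comm (γ := Fin L), Finset.sum_comm (γ := Fin M)]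
  rw [hsum, fullExpectation_output hO hA hρ₀ hP,
    fullExpectation_sq_observableMean_sub hO hA hρ₀ hP hN, add_div, add_div, add_div]
  gcongr
  exact outputExpectation_outputError_le hA hρ₀ hP hN

theorem exists_fullExpectation_le_of_le_mul_fullError :
    ∃ C, ∀ (N₀ : ℕ) (K : ℝ) (f : FullRecord A M N₀ → ℝ), 0 < N₀ → 0 ≤ K →
      (∀ r, f r ≤ K * fullError A ρ₀ P hO r) →
      fullExpectation A ρ₀ P hO f ≤ K * C / fullCopies A N₀ := by
  classical
  obtain ⟨C, hC⟩ := exists_fullExpectation_fullError_le hO hA hρ₀ hP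
  have hcopies : (L : ℝ) + Fintype.card {a : Fin L // ¬ IsTP (A a)} + 2 ≠ 0 := by positivity
  refine ⟨C * (L + Fintype.card {a : Fin L // ¬ IsTP (A a)} + 2), fun N₀ K f hN hK hf => ?_⟩
  calc fullExpectation A ρ₀ P hO f
      ≤ fullRecordProb A ρ₀ P hO ⬝ᵥ (K • fullError A ρ₀ P hO) :=
        dotProduct_le_dotProduct_of_nonneg_left hf (fullRecordProb_mem_stdSimplex hO hA hρ₀ hP).1
    _ = K * fullExpectation (N₀ := N₀) A ρ₀ P hO (fullError A ρ₀ P hO) := dotProduct_smul ..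
    _ ≤ K * (C / N₀) := mul_le_mul_of_nonneg_left (hC N₀ hN) hK
    _ = K * (C * (L + Fintype.card {a : Fin L // ¬ IsTP (A a)} + 2)) / fullCopies A N₀ := by
        simp only [fullCopies, Nat.cast_mul, Nat.cast_add, Nat.cast_ofNat]
        field_simp [hcopies]

end

end Records

/-! ### Error bounds for the two algorithms -/

section Algorithms

open Filter Asymptotics Topology

variable {d L M : ℕ} {A : Fin L → Fin (d ^ 2) → Matrix (Fin d) (Fin d) ℂ}
  {ρ₀ : Matrix (Fin d) (Fin d) ℂ} {P : Fin M → Matrix (Fin d) (Fin d) ℂ}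

theorem IsPOVM.card_ne_zero (hP : IsPOVM P) (hd : d ≠ 0) : M ≠ 0 := by
  rintro rfl
  have : NeZero d := ⟨hd⟩
  exact zero_ne_one (α := Matrix (Fin d) (Fin d) ℂ) (by simpa using hP.2)

section Data

variable {N₀ : ℕ}

theorem sq_yHat_sub_le_outputError (r : OutputRecord L M N₀) (a : Fin L) (j : Fin M) :
    (yHat r a j - (P j * applyKraus (A a) ρ₀).trace.re) ^ 2 ≤ outputError A ρ₀ P r :=
  (Finset.single_le_sum (f := fun j => (yHat r a j - (P j * applyKraus (A a) ρ₀).trace.re) ^ 2)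
    (fun _ _ => sq_nonneg _) (Finset.mem_univ j)).trans <|
  Finset.single_le_sum
    (f := fun a => ∑ j, (yHat r a j - (P j * applyKraus (A a) ρ₀).trace.re) ^ 2)
    (fun _ _ => by positivity) (Finset.mem_univ a)

variable {O : Matrix (Fin d) (Fin d) ℂ} (hO : O.IsHermitian) (r : FullRecord A M N₀)

theorem outputError_le_fullError : outputError A ρ₀ P r.1 ≤ fullError A ρ₀ P hO r := by
  rw [fullError, add_assoc, add_assoc]
  exact le_add_of_nonneg_right (by positivity)

theorem sq_xHatZero_sub_le_fullError (a : Fin L) :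
    (xHatZero r a - (applyKraus (A a) ρ₀).trace.re / √d) ^ 2 ≤ fullError A ρ₀ P hO r := by
  have h := Finset.single_le_sum
    (f := fun a => (xHatZero r a - (applyKraus (A a) ρ₀).trace.re / √d) ^ 2)
    (fun _ _ => sq_nonneg _) (Finset.mem_univ a)
  exact le_add_of_le_of_nonneg (le_add_of_le_of_nonneg
    (le_add_of_nonneg_of_le (outputError_nonneg r.1) h) (by positivity)) (by positivity)

theorem sq_cHatZero_sub_le_fullError (j : Fin M) :
    (cHatZero r j - (P j).trace.re / √d) ^ 2 ≤ fullError A ρ₀ P hO r := by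
  have h := Finset.single_le_sum (f := fun j => (cHatZero r j - (P j).trace.re / √d) ^ 2)
    (fun _ _ => sq_nonneg _) (Finset.mem_univ j)
  exact le_add_of_le_of_nonneg (le_add_of_nonneg_of_le
    (add_nonneg (outputError_nonneg r.1) (by positivity)) h) (by positivity)

theorem sq_observableMean_sub_le_fullError :
    (observableMean hO r - (O * ρ₀).trace.re) ^ 2 ≤ fullError A ρ₀ P hO r := by
  have := outputError_nonneg (A := A) (ρ₀ := ρ₀) (P := P) r.1
  exact le_add_of_nonneg_left (by positivity)

end Data

theorem sum_frobSq_sub_le (X Y : Fin M → Matrix (Fin d) (Fin d) ℂ) :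
    ∑ j, frobSq (X j - Y j) ≤ M * ‖X - Y‖ ^ 2 := by
  calc ∑ j, frobSq (X j - Y j) ≤ ∑ _j : Fin M, ‖X - Y‖ ^ 2 := by
        gcongr with j
        rw [frobSq_eq_norm_sq]
        gcongr
        exact norm_le_pi_norm (X - Y) j
    _ = M * ‖X - Y‖ ^ 2 := by simp

theorem IsPOVM.norm_sub_le {Q : Fin M → Matrix (Fin d) (Fin d) ℂ} (hQ : IsPOVM Q)
    (hP : IsPOVM P) : ‖Q - P‖ ≤ d + d :=
  (pi_norm_le_iff_of_nonneg (by positivity)).2 fun j =>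
    norm_sub_le_of_le (hQ.norm_le j) (hP.norm_le j)

variable {ι : Type*} {l : Filter ι} {N : ι → ℕ}

theorem isBigO_sub_of_isBigO_vec_sub {n : Type*} [Fintype n] {e : ι → ℝ}
    {X : ι → Matrix n n ℂ} {X₀ : Matrix n n ℂ}
    (h : (fun i => Matrix.vec (X i) - Matrix.vec X₀) =O[l] e) : (fun i => X i - X₀) =O[l] e :=
  isBigO_linearMap_sub (𝕜 := ℂ) ((LinearEquiv.curry ℂ ℂ n n ≪≫ₗ
    Matrix.ofLinearEquiv ℂ ≪≫ₗ Matrix.transposeLinearEquiv n n ℂ ℂ).toLinearMap) h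

section Orthonormal

section Data

variable {O : Matrix (Fin d) (Fin d) ℂ} (hO : O.IsHermitian) (r : ∀ i, FullRecord A M (N i))

theorem isBigO_cHatZero_sub (j : Fin M) : (fun i => cHatZero (r i) j - (P j).trace.re / √d) =O[l]
    fun i => √(fullError A ρ₀ P hO (r i)) :=
  .of_norm_le fun i => Real.abs_le_sqrt (sq_cHatZero_sub_le_fullError hO (r i) j)

theorem isBigO_observableMean_sub : (fun i => observableMean hO (r i) - (O * ρ₀).trace.re) =O[l]
    fun i => √(fullError A ρ₀ P hO (r i)) :=
  .of_norm_le fun i => Real.abs_le_sqrt (sq_observableMean_sub_le_fullError hO (r i))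

end Data

variable {Ω : Fin (d ^ 2 - 1) → Matrix (Fin d) (Fin d) ℂ} (hΩ : IsTracelessBasis Ω)
  (k₀ : Fin (d ^ 2 - 1)) (hρ₀ : IsDensity ρ₀) (hP : IsPOVM P)
  (hA : ∀ a, IsGeneralizedUnital (A a)) (hrank : (designB Ω A).rank = (d ^ 2 - 1) ^ 2)
  {r : ∀ i, FullRecord A M (N i)}
  (hr : Tendsto (fun i => √(fullError A ρ₀ P (hΩ.herm k₀) (r i))) l (𝓝 0))
include hρ₀ hP hA hr

theorem isBigO_YHat_sub (j : Fin M) :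
    (fun i => YHat (r i) j - designB Ω A *ᵥ fun p => coeff Ω ρ₀ p.1 * coeff Ω (P j) p.2) =O[l]
      fun i => √(fullError A ρ₀ P (hΩ.herm k₀) (r i)) := by
  rw [hΩ.designB_mulVec hρ₀.dim_ne_zero hA hρ₀.1.1 (hP.1 j).1]
  refine isBigO_pi.2 fun a => ?_
  have hy : (fun i => yHat (r i).1 a j - (P j * applyKraus (A a) ρ₀).trace.re) =O[l]
      fun i => √(fullError A ρ₀ P (hΩ.herm k₀) (r i)) :=
    .of_norm_le fun i => Real.abs_le_sqrt <|
      (sq_yHat_sub_le_outputError _ a j).trans (outputError_le_fullError _ _)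
  have hx : (fun i => xHatZero (r i) a - (applyKraus (A a) ρ₀).trace.re / √d) =O[l]
      fun i => √(fullError A ρ₀ P (hΩ.herm k₀) (r i)) :=
    .of_norm_le fun i => Real.abs_le_sqrt (sq_xHatZero_sub_le_fullError _ _ a)
  refine (hy.sub (isBigO_mul_sub hr hx (isBigO_cHatZero_sub _ _ j))).congr_left fun i => ?_
  simp only [Pi.sub_apply, YHat]
  ring

include hrank

theorem isBigO_orthonormalFactors_sub {j : Fin M} {x c : ι → Fin (d ^ 2 - 1) → ℝ}
    (h : ∀ i, IsSVDFactor (leastSquares (designB Ω A) (YHat (r i) j)) (x i) (c i)) :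
    (fun i => Matrix.vecMulVec (x i) (c i) - Matrix.vecMulVec (coeff Ω ρ₀) (coeff Ω (P j))) =O[l]
      fun i => √(fullError A ρ₀ P (hΩ.herm k₀) (r i)) :=
  isBigO_vecMulVec_sub_of_isSVDFactor (by simp [hrank, sq]) h
    (isBigO_YHat_sub hΩ k₀ hρ₀ hP hA hr j)

variable (hk₀ : coeff Ω ρ₀ k₀ ≠ 0) {ρh : ι → Matrix (Fin d) (Fin d) ℂ}
  {Ph : ι → Fin M → Matrix (Fin d) (Fin d) ℂ}
include hk₀

theorem isBigO_orthonormal_detector {ch : ι → StateChoice M}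
    (h : ∀ i, IsOrthonormalOutput hΩ k₀ A (ch i) (r i) (ρh i) (Ph i)) :
    (fun i => Ph i - P) =O[l] fun i => √(fullError A ρ₀ P (hΩ.herm k₀) (r i)) := by
  choose x c hsvd xb cb _ hcb _ hdet using h
  refine isBigO_detectorCorrection hr hP hdet fun j => ?_
  have hcoeff : (fun i => cb i j - coeff Ω (P j)) =O[l]
      fun i => √(fullError A ρ₀ P (hΩ.herm k₀) (r i)) := by
    simpa only [hcb, single_one_dotProduct] using isBigO_div_smul_right_sub hr
      (isBigO_orthonormalFactors_sub hΩ k₀ hρ₀ hP hA hrank hr fun i => hsvd i j)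
      (w := Pi.single k₀ 1) (by rwa [single_one_dotProduct])
      (by rw [single_one_dotProduct]; exact isBigO_observableMean_sub (hΩ.herm k₀) r)
  have hpair : (fun i => (cHatZero (r i) j, cb i j) - ((P j).trace.re / √d, coeff Ω (P j))) =O[l]
      fun i => √(fullError A ρ₀ P (hΩ.herm k₀) (r i)) :=
    (isBigO_cHatZero_sub _ _ j).prod_left hcoeff
  have hlin := isBigO_linearMap_sub (𝕜 := ℝ) (synthesis Ω) hpair
  rwa [hΩ.synthesis_coeff hρ₀.dim_ne_zero (hP.1 j).1] at hlin

theorem isBigO_orthonormal_state {ch : StateChoice M}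
    (huse : ∀ j, ch.Uses j → ∃ k, coeff Ω (P j) k ≠ 0)
    (h : ∀ i, IsOrthonormalOutput hΩ k₀ A ch (r i) (ρh i) (Ph i)) :
    (fun i => ρh i - ρ₀) =O[l] fun i => √(fullError A ρ₀ P (hΩ.herm k₀) (r i)) := by
  have hd := hρ₀.dim_ne_zero
  choose x c hsvd xb cb hxb _ hstate _ using h
  have hcoeff : (fun i => xb i - coeff Ω ρ₀) =O[l]
      fun i => √(fullError A ρ₀ P (hΩ.herm k₀) (r i)) := by
    simp only [hxb]
    refine ch.isBigO_combine_sub (hP.card_ne_zero hd) fun j hj => ?_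
    simpa only [single_one_dotProduct] using isBigO_div_smul_left_sub hr
      (isBigO_orthonormalFactors_sub hΩ k₀ hρ₀ hP hA hrank hr fun i => hsvd i j)
      (w := Pi.single k₀ 1) (by rwa [single_one_dotProduct])
      (by rw [single_one_dotProduct]; exact isBigO_observableMean_sub (hΩ.herm k₀) r)
      (Function.ne_iff.2 (huse j hj))
  have hpair : (fun i => (1 / √d, xb i) - (ρ₀.trace.re / √d, coeff Ω ρ₀)) =O[l]
      fun i => √(fullError A ρ₀ P (hΩ.herm k₀) (r i)) := by
    simpa [hρ₀.2] using (isBigO_zero (fun i => √(fullError A ρ₀ P (hΩ.herm k₀) (r i))) l).prod_left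
      hcoeff
  have hlin := isBigO_linearMap_sub (𝕜 := ℝ) (synthesis Ω) hpair
  rw [hΩ.synthesis_coeff hd hρ₀.1.1] at hlin
  refine isBigO_stateCorrection hρ₀ hstate (.of_forall fun i => ?_) hlin
  have hsqrt : √(d : ℝ) ≠ 0 := by positivity
  rw [← synthesis_apply, hΩ.trace_synthesis, one_div_mul_cancel hsqrt, Complex.ofReal_one]

end Orthonormal

section Natural

variable (hρ₀ : IsDensity ρ₀) (hP : IsPOVM P) (hrank : (designNatural A).rank = d ^ 4)
  {r : ∀ i, OutputRecord L M (N i)}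
include hρ₀ hP hrank

theorem isBigO_naturalFactors_sub {j : Fin M} {ρs Ps : ι → Matrix (Fin d) (Fin d) ℂ}
    (h : ∀ i, IsSVDFactor (leastSquares (designNatural A) (fun a => (yHat (r i) a j : ℂ)))
      (Matrix.vec (ρs i)) (Matrix.vec (Ps i)ᵀ)) :
    (fun i => Matrix.vecMulVec (Matrix.vec (ρs i)) (Matrix.vec (Ps i)ᵀ) -
      Matrix.vecMulVec (Matrix.vec ρ₀) (Matrix.vec (P j)ᵀ)) =O[l]
      fun i => √(outputError A ρ₀ P (r i)) := by
  have hcard : (designNatural A).rank =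
      Fintype.card ((Fin d × Fin d) × (Fin d × Fin d)) := by
    simp only [hrank, Fintype.card_prod, Fintype.card_fin]
    ring
  refine isBigO_vecMulVec_sub_of_isSVDFactor hcard h (isBigO_pi.2 fun a => .of_norm_le fun i => ?_)
  rw [designNatural_mulVec, Pi.sub_apply,
    trace_mul_eq_ofReal (hP.1 j).1 (posSemidef_applyKraus (A a) hρ₀.1).1, ← Complex.ofReal_sub,
    Complex.norm_real]
  exact Real.abs_le_sqrt (sq_yHat_sub_le_outputError _ a j)

variable (hr : Tendsto (fun i => √(outputError A ρ₀ P (r i))) l (𝓝 0))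
  {ρh : ι → Matrix (Fin d) (Fin d) ℂ} {Ph : ι → Fin M → Matrix (Fin d) (Fin d) ℂ}
include hr

theorem isBigO_natural_detector {ch : ι → StateChoice M}
    (h : ∀ i, IsNaturalOutput A (ch i) (r i) (ρh i) (Ph i)) :
    (fun i => Ph i - P) =O[l] fun i => √(outputError A ρ₀ P (r i)) := by
  choose ρs Ps hsvd _ _ Pt _ hPt _ _ hdet using h
  refine isBigO_detectorCorrection hr hP hdet fun j => ?_
  have hvec : (fun i => Matrix.vec (Pt i j)ᵀ - Matrix.vec (P j)ᵀ) =O[l]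
      fun i => √(outputError A ρ₀ P (r i)) := by
    have hscaled := isBigO_dotProduct_smul_sub (l := l) (Matrix.vec 1)
      (isBigO_naturalFactors_sub hρ₀ hP hrank fun i => hsvd i j)
    simpa [hPt, Matrix.vec_dotProduct_vec, hρ₀.2] using hscaled
  refine IsBigO.trans (.of_norm_le fun i => norm_hermitianPart_sub_le (hP.1 j).1) ?_
  refine ((isBigO_sub_of_isBigO_vec_sub hvec).norm_left).congr_left fun i => ?_
  rw [← Matrix.transpose_sub, Matrix.frobenius_norm_transpose]

theorem isBigO_trace_inv_smul_sub {j : Fin M} {ρs Ps : ι → Matrix (Fin d) (Fin d) ℂ}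
    (h : ∀ i, IsSVDFactor (leastSquares (designNatural A) (fun a => (yHat (r i) a j : ℂ)))
      (Matrix.vec (ρs i)) (Matrix.vec (Ps i)ᵀ)) (hj : P j ≠ 0) :
    (fun i => (ρs i).trace⁻¹ • ρs i - ρ₀) =O[l] fun i => √(outputError A ρ₀ P (r i)) := by
  refine isBigO_sub_of_isBigO_vec_sub ?_
  have hscaled := isBigO_div_smul_left_sub hr (isBigO_naturalFactors_sub hρ₀ hP hrank h)
    (w := Matrix.vec 1) (μ := fun _ => 1) (by simp [Matrix.vec_dotProduct_vec, hρ₀.2])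
    (by simpa [Matrix.vec_dotProduct_vec, hρ₀.2] using isBigO_zero _ _) (by simpa using hj)
  simpa [Matrix.vec_dotProduct_vec] using hscaled

theorem isBigO_natural_state {ch : StateChoice M} (huse : ∀ j, ch.Uses j → P j ≠ 0)
    (h : ∀ i, IsNaturalOutput A ch (r i) (ρh i) (Ph i)) :
    (fun i => ρh i - ρ₀) =O[l] fun i => √(outputError A ρ₀ P (r i)) := by
  have hM := hP.card_ne_zero hρ₀.dim_ne_zero
  choose ρs Ps hsvd ρt ρ' _ hρt _ hρ' hstate _ using h
  have hne : ∀ᶠ i in l, ∀ j, ch.Uses j → (ρs i j).trace ≠ 0 := by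
    refine eventually_all.2 fun j => eventually_imp_distrib_left.2 fun hj => ?_
    simpa [Matrix.vec_dotProduct_vec] using eventually_dotProduct_ne_zero hr
      (isBigO_naturalFactors_sub hρ₀ hP hrank fun i => hsvd i j) (w := Matrix.vec 1)
      (by simp [Matrix.vec_dotProduct_vec, hρ₀.2]) (by simpa using huse j hj)
  have htr : ∀ᶠ i in l, (ρ' i).trace = 1 := by
    filter_upwards [hne] with i hi
    have : (ρt i).trace = 1 := by
      rw [hρt]
      exact ch.trace_combine hM fun j hj => by simp [hi j hj]
    norm_num [hρ', Matrix.trace_smul, this]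
  have hherm : (fun i => ρ' i - ρ₀) =O[l] fun i => √(outputError A ρ₀ P (r i)) := by
    have hcombine : (fun i => ρt i - ρ₀) =O[l] fun i => √(outputError A ρ₀ P (r i)) := by
      simp only [hρt]
      exact ch.isBigO_combine_sub hM fun j hj =>
        isBigO_trace_inv_smul_sub hρ₀ hP hrank hr (fun i => hsvd i j) (huse j hj)
    refine IsBigO.trans (.of_norm_le fun i => ?_) hcombine.norm_left
    rw [hρ']
    exact norm_hermitianPart_sub_le hρ₀.1.1
  refine isBigO_stateCorrection hρ₀ hstate ?_ (hherm.congr' ?_ .rfl)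
  · filter_upwards [htr] with i hi using by simp [hi]
  · filter_upwards [htr] with i hi using by simp [hi]

end Natural

section Outputs

variable {N₀ : ℕ} {ch : StateChoice M} {ρh : Matrix (Fin d) (Fin d) ℂ}
  {Ph : Fin M → Matrix (Fin d) (Fin d) ℂ}

namespace IsOrthonormalOutput

variable {Ω : Fin (d ^ 2 - 1) → Matrix (Fin d) (Fin d) ℂ} {hΩ : IsTracelessBasis Ω}
  {k₀ : Fin (d ^ 2 - 1)} {r : FullRecord A M N₀}

theorem isDensity (h : IsOrthonormalOutput hΩ k₀ A ch r ρh Ph) : IsDensity ρh := by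
  obtain ⟨_, _, _, _, _, _, _, hstate, _⟩ := h
  exact hstate.1

theorem isPOVM (h : IsOrthonormalOutput hΩ k₀ A ch r ρh Ph) : IsPOVM Ph := by
  obtain ⟨_, _, _, _, _, _, _, _, hdet⟩ := h
  exact hdet.1

end IsOrthonormalOutput

namespace IsNaturalOutput

variable {r : OutputRecord L M N₀}

theorem isDensity (h : IsNaturalOutput A ch r ρh Ph) : IsDensity ρh := by
  obtain ⟨_, _, _, _, _, _, _, _, _, hstate, _⟩ := h
  exact hstate.1

theorem isPOVM (h : IsNaturalOutput A ch r ρh Ph) : IsPOVM Ph := by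
  obtain ⟨_, _, _, _, _, _, _, _, _, _, hdet⟩ := h
  exact hdet.1

end IsNaturalOutput

end Outputs

section UniformBounds

variable (hρ₀ : IsDensity ρ₀) (hP : IsPOVM P)
include hρ₀ hP

section Orthonormal

variable {Ω : Fin (d ^ 2 - 1) → Matrix (Fin d) (Fin d) ℂ} (hΩ : IsTracelessBasis Ω)
  (k₀ : Fin (d ^ 2 - 1)) (hA : ∀ a, IsGeneralizedUnital (A a))
  (hrank : (designB Ω A).rank = (d ^ 2 - 1) ^ 2) (hk₀ : coeff Ω ρ₀ k₀ ≠ 0)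
include hA hrank hk₀

theorem exists_orthonormal_detector_le : ∃ K, 0 ≤ K ∧
    ∀ (ch : StateChoice M) (N₀ : ℕ) (r : FullRecord A M N₀) (ρh : Matrix (Fin d) (Fin d) ℂ)
      (Ph : Fin M → Matrix (Fin d) (Fin d) ℂ), IsOrthonormalOutput hΩ k₀ A ch r ρh Ph →
      ∑ j, frobSq (Ph j - P j) ≤ K * fullError A ρ₀ P (hΩ.herm k₀) r := by
  let Run := Σ' (ch : StateChoice M) (N₀ : ℕ) (r : FullRecord A M N₀)
    (ρh : Matrix (Fin d) (Fin d) ℂ) (Ph : Fin M → Matrix (Fin d) (Fin d) ℂ),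
    IsOrthonormalOutput hΩ k₀ A ch r ρh Ph
  let err : Run → ℝ := fun i => fullError A ρ₀ P (hΩ.herm k₀) i.2.2.1
  obtain ⟨K, hK, h⟩ := exists_sq_norm_le_mul_of_isBigO_sqrt (err := err)
    (fun _ => fullError_nonneg _ _)
    (fun i => i.2.2.2.2.2.isPOVM.norm_sub_le hP)
    (isBigO_orthonormal_detector hΩ k₀ hρ₀ hP hA hrank (tendsto_sqrt_comap_nhds_zero err) hk₀
      fun i => i.2.2.2.2.2)
  refine ⟨M * K, by positivity, fun ch N₀ r ρh Ph hout => ?_⟩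
  calc ∑ j, frobSq (Ph j - P j) ≤ M * ‖Ph - P‖ ^ 2 := sum_frobSq_sub_le Ph P
    _ ≤ M * (K * fullError A ρ₀ P (hΩ.herm k₀) r) := by
      gcongr
      exact h ⟨ch, N₀, r, ρh, Ph, hout⟩
    _ = _ := (mul_assoc ..).symm

theorem exists_orthonormal_state_le {ch : StateChoice M}
    (huse : ∀ j, ch.Uses j → ∃ k, coeff Ω (P j) k ≠ 0) :
    ∃ K, ∀ (N₀ : ℕ) (r : FullRecord A M N₀) (ρh : Matrix (Fin d) (Fin d) ℂ)
      (Ph : Fin M → Matrix (Fin d) (Fin d) ℂ), IsOrthonormalOutput hΩ k₀ A ch r ρh Ph →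
      frobSq (ρh - ρ₀) ≤ K * fullError A ρ₀ P (hΩ.herm k₀) r := by
  let Run := Σ' (N₀ : ℕ) (r : FullRecord A M N₀) (ρh : Matrix (Fin d) (Fin d) ℂ)
    (Ph : Fin M → Matrix (Fin d) (Fin d) ℂ), IsOrthonormalOutput hΩ k₀ A ch r ρh Ph
  let err : Run → ℝ := fun i => fullError A ρ₀ P (hΩ.herm k₀) i.2.1
  obtain ⟨K, -, h⟩ := exists_sq_norm_le_mul_of_isBigO_sqrt (err := err)
    (fun _ => fullError_nonneg _ _)
    (fun i => norm_sub_le_of_le i.2.2.2.2.isDensity.norm_le_one hρ₀.norm_le_one)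
    (isBigO_orthonormal_state hΩ k₀ hρ₀ hP hA hrank (tendsto_sqrt_comap_nhds_zero err) hk₀ huse
      fun i => i.2.2.2.2)
  refine ⟨K, fun N₀ r ρh Ph hout => ?_⟩
  rw [frobSq_eq_norm_sq]
  exact h ⟨N₀, r, ρh, Ph, hout⟩

theorem exists_orthonormal_error_le : ∃ K, 0 ≤ K ∧
    ∀ (ch : StateChoice M) (N₀ : ℕ) (r : FullRecord A M N₀) (ρh : Matrix (Fin d) (Fin d) ℂ)
      (Ph : Fin M → Matrix (Fin d) (Fin d) ℂ), IsOrthonormalOutput hΩ k₀ A ch r ρh Ph →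
      ((∀ j, ch.Uses j → ∃ k, coeff Ω (P j) k ≠ 0) →
        frobSq (ρh - ρ₀) ≤ K * fullError A ρ₀ P (hΩ.herm k₀) r) ∧
      ∑ j, frobSq (Ph j - P j) ≤ K * fullError A ρ₀ P (hΩ.herm k₀) r := by
  obtain ⟨K₁, hK₁, hdet⟩ := exists_orthonormal_detector_le hρ₀ hP hΩ k₀ hA hrank hk₀
  choose K₂ hstate using fun ch : {ch : StateChoice M //
    ∀ j, ch.Uses j → ∃ k, coeff Ω (P j) k ≠ 0} =>
    exists_orthonormal_state_le hρ₀ hP hΩ k₀ hA hrank hk₀ ch.2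
  obtain ⟨K₃, hK₃⟩ := Finite.exists_le K₂
  refine ⟨max K₁ K₃, hK₁.trans (le_max_left _ _), fun ch N₀ r ρh Ph hout => ?_⟩
  have herr := fullError_nonneg (A := A) (ρ₀ := ρ₀) (P := P) (hΩ.herm k₀) r
  refine ⟨fun huse => (hstate ⟨ch, huse⟩ N₀ r ρh Ph hout).trans ?_,
    (hdet ch N₀ r ρh Ph hout).trans ?_⟩
  · gcongr
    exact (hK₃ _).trans (le_max_right _ _)
  · gcongr
    exact le_max_left _ _

end Orthonormal

section Natural

variable (hrank : (designNatural A).rank = d ^ 4)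
include hrank

theorem exists_natural_detector_le : ∃ K, 0 ≤ K ∧
    ∀ (ch : StateChoice M) (N₀ : ℕ) (r : OutputRecord L M N₀) (ρh : Matrix (Fin d) (Fin d) ℂ)
      (Ph : Fin M → Matrix (Fin d) (Fin d) ℂ), IsNaturalOutput A ch r ρh Ph →
      ∑ j, frobSq (Ph j - P j) ≤ K * outputError A ρ₀ P r := by
  let Run := Σ' (ch : StateChoice M) (N₀ : ℕ) (r : OutputRecord L M N₀)
    (ρh : Matrix (Fin d) (Fin d) ℂ) (Ph : Fin M → Matrix (Fin d) (Fin d) ℂ),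
    IsNaturalOutput A ch r ρh Ph
  let err : Run → ℝ := fun i => outputError A ρ₀ P i.2.2.1
  obtain ⟨K, hK, h⟩ := exists_sq_norm_le_mul_of_isBigO_sqrt (err := err)
    (fun _ => outputError_nonneg _)
    (fun i => i.2.2.2.2.2.isPOVM.norm_sub_le hP)
    (isBigO_natural_detector hρ₀ hP hrank (tendsto_sqrt_comap_nhds_zero err)
      fun i => i.2.2.2.2.2)
  refine ⟨M * K, by positivity, fun ch N₀ r ρh Ph hout => ?_⟩
  calc ∑ j, frobSq (Ph j - P j) ≤ M * ‖Ph - P‖ ^ 2 := sum_frobSq_sub_le Ph P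
    _ ≤ M * (K * outputError A ρ₀ P r) := by
      gcongr
      exact h ⟨ch, N₀, r, ρh, Ph, hout⟩
    _ = _ := (mul_assoc ..).symm

theorem exists_natural_state_le {ch : StateChoice M} (huse : ∀ j, ch.Uses j → P j ≠ 0) :
    ∃ K, ∀ (N₀ : ℕ) (r : OutputRecord L M N₀) (ρh : Matrix (Fin d) (Fin d) ℂ)
      (Ph : Fin M → Matrix (Fin d) (Fin d) ℂ), IsNaturalOutput A ch r ρh Ph →
      frobSq (ρh - ρ₀) ≤ K * outputError A ρ₀ P r := by
  let Run := Σ' (N₀ : ℕ) (r : OutputRecord L M N₀) (ρh : Matrix (Fin d) (Fin d) ℂ)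
    (Ph : Fin M → Matrix (Fin d) (Fin d) ℂ), IsNaturalOutput A ch r ρh Ph
  let err : Run → ℝ := fun i => outputError A ρ₀ P i.2.1
  obtain ⟨K, -, h⟩ := exists_sq_norm_le_mul_of_isBigO_sqrt (err := err)
    (fun _ => outputError_nonneg _)
    (fun i => norm_sub_le_of_le i.2.2.2.2.isDensity.norm_le_one hρ₀.norm_le_one)
    (isBigO_natural_state hρ₀ hP hrank (tendsto_sqrt_comap_nhds_zero err) huse
      fun i => i.2.2.2.2)
  refine ⟨K, fun N₀ r ρh Ph hout => ?_⟩
  rw [frobSq_eq_norm_sq]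
  exact h ⟨N₀, r, ρh, Ph, hout⟩

theorem exists_natural_error_le : ∃ K, 0 ≤ K ∧
    ∀ (ch : StateChoice M) (N₀ : ℕ) (r : OutputRecord L M N₀) (ρh : Matrix (Fin d) (Fin d) ℂ)
      (Ph : Fin M → Matrix (Fin d) (Fin d) ℂ), IsNaturalOutput A ch r ρh Ph →
      ((∀ j, ch.Uses j → P j ≠ 0) → frobSq (ρh - ρ₀) ≤ K * outputError A ρ₀ P r) ∧
      ∑ j, frobSq (Ph j - P j) ≤ K * outputError A ρ₀ P r := by
  obtain ⟨K₁, hK₁, hdet⟩ := exists_natural_detector_le hρ₀ hP hrank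
  choose K₂ hstate using fun ch : {ch : StateChoice M // ∀ j, ch.Uses j → P j ≠ 0} =>
    exists_natural_state_le hρ₀ hP hrank ch.2
  obtain ⟨K₃, hK₃⟩ := Finite.exists_le K₂
  refine ⟨max K₁ K₃, hK₁.trans (le_max_left _ _), fun ch N₀ r ρh Ph hout => ?_⟩
  have herr := outputError_nonneg (A := A) (ρ₀ := ρ₀) (P := P) r
  refine ⟨fun huse => (hstate ⟨ch, huse⟩ N₀ r ρh Ph hout).trans ?_,
    (hdet ch N₀ r ρh Ph hout).trans ?_⟩
  · gcongr
    exact (hK₃ _).trans (le_max_right _ _)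
  · gcongr
    exact le_max_left _ _

end Natural

end UniformBounds

theorem card_processes_pos (hd : d ≠ 0) (hrank : (designNatural A).rank = d ^ 4) : 0 < L := by
  have h := Matrix.rank_le_card_height (designNatural A)
  rw [hrank, Fintype.card_fin] at h
  exact (by positivity : 0 < d ^ 4).trans_le h

end Algorithms

end SimulTomo

theorem theorem3 {d L M : ℕ}
    (A : Fin L → Fin (d ^ 2) → Matrix (Fin d) (Fin d) ℂ)
    (hA : ∀ a, SimulTomo.IsProcess (A a))
    (ρ₀ : Matrix (Fin d) (Fin d) ℂ) (hρ₀ : SimulTomo.IsDensity ρ₀)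
    (P : Fin M → Matrix (Fin d) (Fin d) ℂ) (hP : SimulTomo.IsPOVM P) :
    -- orthonormal-basis algorithm
    (∀ (Ω : Fin (d ^ 2 - 1) → Matrix (Fin d) (Fin d) ℂ) (hΩ : SimulTomo.IsTracelessBasis Ω)
        (k₀ : Fin (d ^ 2 - 1)),
      (∀ a, SimulTomo.IsGeneralizedUnital (A a)) →
      (SimulTomo.designB Ω A).rank = (d ^ 2 - 1) ^ 2 →
      SimulTomo.coeff Ω ρ₀ k₀ ≠ 0 →
      ∃ K : ℝ, ∀ N₀ : ℕ, 0 < N₀ →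
        ∀ (ch : SimulTomo.StateChoice M)
          (ρh : SimulTomo.FullRecord A M N₀ → Matrix (Fin d) (Fin d) ℂ)
          (Ph : SimulTomo.FullRecord A M N₀ → Fin M → Matrix (Fin d) (Fin d) ℂ),
          (∀ r, SimulTomo.IsOrthonormalOutput hΩ k₀ A ch r (ρh r) (Ph r)) →
          ((∀ j, ch.Uses j → ∃ k, SimulTomo.coeff Ω (P j) k ≠ 0) →
            SimulTomo.fullExpectation A ρ₀ P (hΩ.herm k₀)
              (fun r => SimulTomo.frobSq (ρh r - ρ₀)) ≤ K / SimulTomo.fullCopies A N₀) ∧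
          SimulTomo.fullExpectation A ρ₀ P (hΩ.herm k₀)
            (fun r => ∑ j, SimulTomo.frobSq (Ph r j - P j)) ≤ K / SimulTomo.fullCopies A N₀) ∧
    -- natural-basis algorithm
    ((SimulTomo.designNatural A).rank = d ^ 4 →
      ∃ K : ℝ, ∀ N₀ : ℕ, 0 < N₀ →
        ∀ (ch : SimulTomo.StateChoice M)
          (ρh : SimulTomo.OutputRecord L M N₀ → Matrix (Fin d) (Fin d) ℂ)
          (Ph : SimulTomo.OutputRecord L M N₀ → Fin M → Matrix (Fin d) (Fin d) ℂ),
          (∀ r, SimulTomo.IsNaturalOutput A ch r (ρh r) (Ph r)) →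
          ((∀ j, ch.Uses j → P j ≠ 0) →
            SimulTomo.outputExpectation A ρ₀ P
              (fun r => SimulTomo.frobSq (ρh r - ρ₀)) ≤ K / ((L * N₀ : ℕ) : ℝ)) ∧
          SimulTomo.outputExpectation A ρ₀ P
            (fun r => ∑ j, SimulTomo.frobSq (Ph r j - P j)) ≤ K / ((L * N₀ : ℕ) : ℝ)) := by
  refine ⟨fun Ω hΩ k₀ hunital hrank hk₀ => ?_, fun hrank => ?_⟩
  · obtain ⟨K, hK, herr⟩ :=
      SimulTomo.exists_orthonormal_error_le hρ₀ hP hΩ k₀ hunital hrank hk₀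
    obtain ⟨C, hC⟩ :=
      SimulTomo.exists_fullExpectation_le_of_le_mul_fullError (hΩ.herm k₀) hA hρ₀ hP
    exact ⟨K * C, fun N₀ hN ch ρh Ph hout =>
      ⟨fun huse => hC N₀ K _ hN hK fun r => (herr ch N₀ r _ _ (hout r)).1 huse,
        hC N₀ K _ hN hK fun r => (herr ch N₀ r _ _ (hout r)).2⟩⟩
  · obtain ⟨K, hK, herr⟩ := SimulTomo.exists_natural_error_le hρ₀ hP hrank
    have hL := SimulTomo.card_processes_pos hρ₀.dim_ne_zero hrank
    exact ⟨K * (L * M * L), fun N₀ hN ch ρh Ph hout =>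
      ⟨fun huse => SimulTomo.outputExpectation_le_of_le_mul_outputError hA hρ₀ hP hL hN hK
          fun r => (herr ch N₀ r _ _ (hout r)).1 huse,
        SimulTomo.outputExpectation_le_of_le_mul_outputError hA hρ₀ hP hL hN hK
          fun r => (herr ch N₀ r _ _ (hout r)).2⟩⟩
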